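/- For tensors in $\mathbb{C}^m\otimes\mathbb{C}^m\otimes\mathbb{C}^m=A\otimes B\otimes C$ let $\hat\sigma_r$ be the closure of the set of tensors that are sums of $r$ (possibly zero) tensors $u\otimes v\otimes w$, i.e. the variety of tensors of border rank at most $r$. Call a set $E$ of polynomials on $A\otimes B\otimes C$ *nontrivial equations for* $\hat\sigma_r$ if every $P\in E$ vanishes on $\hat\sigma_r$ and some $P\in E$ is not the zero polynomial. For a quotient $\phi:A\to A'$ (a surjective linear map) and $p\ge 0$ let $$T_{A'}^{\wedge p}:\Lambda^pA'\otimes B^*\to\Lambda^{p+1}A'\otimes C,\qquad X\otimes\beta\mapsto\sum_i (X\wedge \phi(u_i))\otimes \beta(v_i)w_i\quad\text{for } T=\sum_i u_i\otimes v_i\otimes w_i ,$$ be the Young flattening of (the image in $A'\otimes B\otimes C$ of) $T$; its maximal minors in fixed bases are polynomials in $T$. Let $n\ge 3$, $m=n^2$, $p=\lfloor (m-1)/2\rfloor$, and let $M_n\in\mathbb{C}^{m}\otimes\mathbb{C}^{m}\otimes\mathbb{C}^{m}$ be the matrix multiplication tensor, i.e. the tensor of the bilinear map $(X,Y)\mapsto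 XY$ on $n\times n$ matrices. Then $M_n$ satisfies nontrivial equations for the variety $\hat\sigma_{2n^2-n+1}$ of tensors of border rank at most $2n^2-n+1$. More precisely: 1. If $n\neq 4$, the maximal minors of $T_A^{\wedge p}$ (with $A'=A$) are nontrivial equations for $\hat\sigma_{2n^2-n+1}$, and all of them vanish at $M_n$. 2. For every $n\ge3$ (including $n=4$) and every quotient $A'$ of $A$ of dimension $2p+1$ (so $A'\cong A$ if $n$ is odd, and $\dim A'=m-1$ if $n$ is even), the maximal minors of $T_{A'}^{\wedge p}$ are nontrivial equations for $\hat\sigma_{2n^2-n+1}$, and all of them vanish at $M_n$. -/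

import Mathlib

/-- Coordinates of tensors in `A ⊗ B ⊗ C`, where `A`, `B`, `C` are free over `R` with bases
`a_i`, `b_j`, `c_k` indexed by `Fin a`, `Fin b`, `Fin c`:
`T` stands for `∑ T i j k • a_i ⊗ b_j ⊗ c_k`. -/
abbrev Tensor3 (R : Type*) (a b c : ℕ) : Type _ := Fin a → Fin b → Fin c → R

/-- The tensors of rank at most `r`: sums of `r` tensors of the form `u ⊗ v ⊗ w`
(some of which may be zero). -/
def rankAtMost (a b c r : ℕ) : Set (Tensor3 ℂ a b c) :=
  {T | ∃ (u : Fin r → Fin a → ℂ) (v : Fin r → Fin b → ℂ) (w : Fin r → Fin c → ℂ),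
    ∀ i j k, T i j k = ∑ s, u s i * v s j * w s k}

/-- The variety of tensors of border rank at most `r`: the (Euclidean) closure of the set of
tensors of rank at most `r`. -/
def borderRankAtMost (a b c r : ℕ) : Set (Tensor3 ℂ a b c) :=
  closure (rankAtMost a b c r)

/-- Polynomials on `ℂ^a ⊗ ℂ^b ⊗ ℂ^c`, in the coordinates of a tensor. -/
abbrev TensorPoly (a b c : ℕ) : Type := MvPolynomial (Fin a × Fin b × Fin c) ℂ

/-- The value of a polynomial at a tensor. -/
noncomputable def TensorPoly.evalAt {a b c : ℕ} (P : TensorPoly a b c) (T : Tensor3 ℂ a b c) : ℂ :=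
  MvPolynomial.eval (fun x => T x.1 x.2.1 x.2.2) P

/-- The tensor whose coordinates are the indeterminates. -/
noncomputable def genericTensor (a b c : ℕ) : Tensor3 (TensorPoly a b c) a b c :=
  fun i j k => MvPolynomial.X (i, j, k)

/-- A set `E` of polynomials is a nontrivial system of equations for the tensors of border rank at
most `r`: they all vanish on these tensors, and they are not all the zero polynomial. -/
def NontrivialEquations {a b c : ℕ} (r : ℕ) (E : Set (TensorPoly a b c)) : Prop :=
  (∀ P ∈ E, ∀ T ∈ borderRankAtMost a b c r, P.evalAt T = 0) ∧ ∃ P ∈ E, P ≠ 0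

/-- The image of a tensor in `A' ⊗ B ⊗ C` under the linear map `A → A'` with matrix `Φ`. -/
def Tensor3.mapA {R : Type*} [CommRing R] [Algebra ℂ R] {a a' b c : ℕ}
    (Φ : Matrix (Fin a') (Fin a) ℂ) (T : Tensor3 R a b c) : Tensor3 R a' b c :=
  fun i' j k => ∑ i, algebraMap ℂ R (Φ i' i) * T i j k

/-- The index set of the basis `a_S = a_{s_1} ∧ ⋯ ∧ a_{s_p}`, `S = {s_1 < ⋯ < s_p}`,
of `Λ^p A`. -/
abbrev WedgeIndex (a p : ℕ) : Type := {S : Finset (Fin a) // S.card = p}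

/-- The coefficient of `a_S` in `a_Q ∧ a_i`: it is zero unless `i ∉ Q` and `S = Q ∪ {i}`, and then
it is the sign of the permutation that moves `i` past the larger elements of `Q`. -/
def wedgeCoeff {a : ℕ} (Q : Finset (Fin a)) (i : Fin a) (S : Finset (Fin a)) : ℤ :=
  if i ∉ Q ∧ S = insert i Q then (-1) ^ (Q.filter (fun q => i < q)).card else 0

/-- The matrix, in the standard bases, of the Young flattening
`T_A^{∧p} : Λ^p A ⊗ B^* → Λ^{p+1} A ⊗ C`,
`a_Q ⊗ b_j^* ↦ ∑_{i,k} T i j k • (a_Q ∧ a_i) ⊗ c_k`. -/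
def youngFlattening {R : Type*} [CommRing R] {a b c : ℕ} (p : ℕ) (T : Tensor3 R a b c) :
    Matrix (WedgeIndex a (p + 1) × Fin c) (WedgeIndex a p × Fin b) R :=
  fun x y => ∑ i, (wedgeCoeff y.1.1 i x.1.1 : R) * T i y.2 x.2

/-- The maximal minors of the Young flattening `T'_{A'}^{∧p} : Λ^p A' ⊗ B^* → Λ^{p+1} A' ⊗ C` of
the image `T' ∈ A' ⊗ B ⊗ C` of `T ∈ A ⊗ B ⊗ C` under the linear map `A → A'` with matrix `Φ`,
as polynomials in the coordinates of `T`. With `Φ = 1` these are the maximal minors of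
`T_A^{∧p}` itself. -/
def youngEquations {a a' b c : ℕ} (Φ : Matrix (Fin a') (Fin a) ℂ) (p : ℕ) :
    Set (TensorPoly a b c) :=
  {P | ∃ (ρ : Fin (min (a'.choose (p + 1) * c) (a'.choose p * b)) ↪ WedgeIndex a' (p + 1) × Fin c)
      (κ : Fin (min (a'.choose (p + 1) * c) (a'.choose p * b)) ↪ WedgeIndex a' p × Fin b),
    P = ((youngFlattening p ((genericTensor a b c).mapA Φ)).submatrix ρ κ).det}

/-- The matrix multiplication tensor `M_n`, in the bases of `ℂ^{n²}` formed by the matrix units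
(and the dual basis for the two arguments): its coordinates are the structure constants of the
product of `n × n` matrices, i.e. `M_n x y z` is the `z`-th entry of the product of the `x`-th and
the `y`-th matrix unit. -/
def matMulTensor (n : ℕ) : Tensor3 ℂ (n * n) (n * n) (n * n) :=
  fun x y z =>
    let unit (t : Fin (n * n)) : Matrix (Fin n) (Fin n) ℂ :=
      Matrix.single (finProdFinEquiv.symm t).1 (finProdFinEquiv.symm t).2 1
    (unit x * unit y) (finProdFinEquiv.symm z).1 (finProdFinEquiv.symm z).2

/-!
The Young flattening of a tensor `∑ u ⊗ v ⊗ w` of rank one is exterior multiplication by `u`, of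
rank at most `(a - 1).choose p`, tensored with a map of rank one. So a tensor of rank at most `r`
has a flattening of rank at most `r * (a - 1).choose p` (`rank_youngFlattening_le`), and when
this is less than the size of the maximal minors, those vanish at all tensors of border rank at
most `r`. They vanish at the matrix multiplication tensor because its flattening is not injective:
the slice at a coordinate of `B` involves only `n` vectors of `A`, and since `n ≤ p` there is a
form of degree `p` divisible by all of them (`evalAt_matMulTensor_eq_zero`).

The minors are not identically zero as soon as one tensor has an injective flattening
(`nontrivialEquations_of_flatteningInjective`). Such tensors are built from the multiplication of
polynomials, so that evaluations at points are available as covectors on `A`. If `g` is the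
polynomial vanishing at the points `x`, then all products `f * g` do so as well, and the contraction
of the kernel condition, paired with `g`, with the evaluations at `x` leaves only a linear relation
with independent coefficients. This makes the components of the kernel element vanish at all
families of points, hence vanish.

For even `n`, the space `B` has even dimension `2 * (p + 1)`, and two copies of the multiplication
of polynomials of degree at most `p` will do (`flatteningInjective_hankelTensor`). For odd `n`, the
dimension of `B` is `2 * p + 1`, and one copy has to be given factors of degrees less than `p` and
at most `p`, the other one factors of degrees at most `p` and less than `p`; the products have
degree less than `2 * p`, and the one remaining dimension of `A` is used for a bilinear form
`θ (f, g)`, depending on `f(X) g(-X)` only, in the two factors of degree at most `p`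
(`twistedHankelTensor`). Here the values of the components at generic points are alternating
polynomials that satisfy an exchange relation. Their quotient by the Vandermonde determinant turns
out to be the list of coefficients of a polynomial that is symmetric in all variables, and its
product `Λ` with all `X i + X j` satisfies a linear relation with the weights of `θ` as
coefficients. If the weights are `M ^ (a ^ 2)` with large `M`, this relation and the divisibility of
`Λ` by all `X i + X j` leave only `Λ = 0`: after rescaling by the weights, the coefficients of `Λ`
with a repeated exponent are small compared to the largest one, and the weighted relation bounds the
others in terms of these (`exists_weights`).
-/

/-! ### Exterior multiplication and contraction in coordinates -/

section Operators

variable {R : Type*} [CommRing R] {a : ℕ}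

/-- The sign of the permutation that moves `i` past the larger elements of `Q`. -/
def wedgeSign (R : Type*) [CommRing R] (Q : Finset (Fin a)) (i : Fin a) : R :=
  (-1) ^ (Q.filter (fun q => i < q)).card

theorem wedgeSign_mul_self (Q : Finset (Fin a)) (i : Fin a) :
    wedgeSign R Q i * wedgeSign R Q i = 1 := by
  unfold wedgeSign
  rw [← mul_pow]; simp

theorem wedgeSign_insert {Q : Finset (Fin a)} {i j : Fin a} (hj : j ∉ Q) :
    wedgeSign R (insert j Q) i = (if i < j then -1 else 1) * wedgeSign R Q i := by
  unfold wedgeSign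
  rw [Finset.filter_insert]
  split_ifs
  · rw [Finset.card_insert_of_notMem (by simp [hj]), pow_succ]; ring
  · simp

/-- The exterior product on the right with the basis vector `a_i`. An element `∑ f S • a_S` of the
exterior algebra of the free module `R ^ a` is encoded by its coordinates
`f : Finset (Fin a) → R`; the sign is that of `wedgeCoeff`. -/
def wedgeBasis (R : Type*) [CommRing R] {a : ℕ} (i : Fin a) :
    Module.End R (Finset (Fin a) → R) where
  toFun f S := if i ∈ S then wedgeSign R (S.erase i) i * f (S.erase i) else 0
  map_add' f g := by ext S; by_cases h : i ∈ S <;> simp [h, mul_add]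
  map_smul' c f := by ext S; by_cases h : i ∈ S <;> simp [h]; ring

/-- Contraction on the right with the `i`-th element of the dual basis, acting on coordinates: the
transpose of `wedgeBasis`. -/
def contractBasis (R : Type*) [CommRing R] {a : ℕ} (i : Fin a) :
    Module.End R (Finset (Fin a) → R) where
  toFun f Q := if i ∈ Q then 0 else wedgeSign R Q i * f (insert i Q)
  map_add' f g := by ext S; by_cases h : i ∈ S <;> simp [h, mul_add]
  map_smul' c f := by ext S; by_cases h : i ∈ S <;> simp [h]; ring

theorem wedgeBasis_apply (i : Fin a) (f : Finset (Fin a) → R) (S : Finset (Fin a)) :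
    wedgeBasis R i f S = if i ∈ S then wedgeSign R (S.erase i) i * f (S.erase i) else 0 := rfl

theorem contractBasis_apply (i : Fin a) (f : Finset (Fin a) → R) (Q : Finset (Fin a)) :
    contractBasis R i f Q = if i ∈ Q then 0 else wedgeSign R Q i * f (insert i Q) := rfl

theorem wedgeBasis_insert {i : Fin a} {Q : Finset (Fin a)} (h : i ∉ Q)
    (f : Finset (Fin a) → R) : wedgeBasis R i f (insert i Q) = wedgeSign R Q i * f Q := by
  simp [wedgeBasis_apply, Finset.erase_insert h]

theorem contractBasis_contractBasis_self (i : Fin a) (f : Finset (Fin a) → R) :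
    contractBasis R i (contractBasis R i f) = 0 := by
  ext Q
  simp [contractBasis_apply]

theorem wedgeBasis_wedgeBasis_self (i : Fin a) (f : Finset (Fin a) → R) :
    wedgeBasis R i (wedgeBasis R i f) = 0 := by
  ext Q
  simp [wedgeBasis_apply]

theorem contractBasis_anticomm {i j : Fin a} (h : i ≠ j) (f : Finset (Fin a) → R) :
    contractBasis R i (contractBasis R j f) = - contractBasis R j (contractBasis R i f) := by
  ext Q
  by_cases hi : i ∈ Q <;> by_cases hj : j ∈ Q <;>
    simp [contractBasis_apply, hi, hj, h, h.symm]
  rw [wedgeSign_insert hi, wedgeSign_insert hj, Finset.insert_comm i j]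
  rcases lt_or_gt_of_ne h with h' | h' <;> simp [h', h'.not_gt] <;> ring

theorem wedgeBasis_anticomm {i j : Fin a} (h : i ≠ j) (f : Finset (Fin a) → R) :
    wedgeBasis R i (wedgeBasis R j f) = - wedgeBasis R j (wedgeBasis R i f) := by
  ext S
  by_cases hi : i ∈ S <;> by_cases hj : j ∈ S <;>
    simp [wedgeBasis_apply, hi, hj, h, h.symm]
  obtain ⟨Q, hiQ, hjQ, rfl⟩ : ∃ Q, i ∉ Q ∧ j ∉ Q ∧ S = insert i (insert j Q) := by
    refine ⟨(S.erase i).erase j, by simp, by simp, ?_⟩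
    rw [Finset.insert_erase (by simp [hj, h.symm]), Finset.insert_erase hi]
  have e1 : (insert i (insert j Q)).erase i = insert j Q := Finset.erase_insert (by simp [h, hiQ])
  have e2 : (insert i (insert j Q)).erase j = insert i Q := by
    rw [Finset.insert_comm]; exact Finset.erase_insert (by simp [h.symm, hjQ])
  rw [e1, e2, Finset.erase_insert hiQ, Finset.erase_insert hjQ, wedgeSign_insert hiQ,
    wedgeSign_insert hjQ]
  rcases lt_or_gt_of_ne h with h' | h' <;> simp [h', h'.not_gt] <;> ring

theorem contractBasis_wedgeBasis_self (i : Fin a) (f : Finset (Fin a) → R) :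
    contractBasis R i (wedgeBasis R i f) + wedgeBasis R i (contractBasis R i f) = f := by
  ext Q
  by_cases hi : i ∈ Q
  · simp [contractBasis_apply, wedgeBasis_apply, hi, ← mul_assoc, wedgeSign_mul_self]
  · simp [contractBasis_apply, wedgeBasis_apply, hi, ← mul_assoc, wedgeSign_mul_self]

theorem contractBasis_wedgeBasis_of_ne {i j : Fin a} (h : i ≠ j) (f : Finset (Fin a) → R) :
    contractBasis R i (wedgeBasis R j f) + wedgeBasis R j (contractBasis R i f) = 0 := by
  ext Q
  by_cases hi : i ∈ Q
  · simp [contractBasis_apply, wedgeBasis_apply, hi, h]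
  by_cases hj : j ∈ Q
  · obtain ⟨P, hjP, rfl⟩ : ∃ P, j ∉ P ∧ Q = insert j P :=
      ⟨Q.erase j, by simp, by rw [Finset.insert_erase hj]⟩
    have hiP : i ∉ P := fun hh => hi (by simp [hh])
    have e2 : (insert i (insert j P)).erase j = insert i P := by
      rw [Finset.insert_comm]; exact Finset.erase_insert (by simp [h.symm, hjP])
    simp only [contractBasis_apply, wedgeBasis_apply, Pi.add_apply, Pi.zero_apply]
    simp only [hi, if_false, Finset.mem_insert, hiP, or_true, if_true, true_or, e2,
      Finset.erase_insert hjP, wedgeSign_insert hiP, wedgeSign_insert hjP]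
    rcases lt_or_gt_of_ne h with h' | h' <;> simp [h', h'.not_gt] <;> ring
  · simp [contractBasis_apply, wedgeBasis_apply, hi, hj, h.symm]

/-- The exterior product on the right with a vector. -/
def wedge (R : Type*) [CommRing R] (a : ℕ) :
    (Fin a → R) →ₗ[R] Module.End R (Finset (Fin a) → R) :=
  ∑ i, (LinearMap.proj i : (Fin a → R) →ₗ[R] R).smulRight (wedgeBasis R i)

/-- Contraction with a covector. -/
def contract (R : Type*) [CommRing R] (a : ℕ) :
    (Fin a → R) →ₗ[R] Module.End R (Finset (Fin a) → R) :=
  ∑ i, (LinearMap.proj i : (Fin a → R) →ₗ[R] R).smulRight (contractBasis R i)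

theorem wedge_apply (v : Fin a → R) (f : Finset (Fin a) → R) :
    wedge R a v f = ∑ i, v i • wedgeBasis R i f := by
  simp [wedge, LinearMap.sum_apply]

theorem contract_apply (v : Fin a → R) (f : Finset (Fin a) → R) :
    contract R a v f = ∑ i, v i • contractBasis R i f := by
  simp [contract, LinearMap.sum_apply]

theorem sum_anticomm_eq_zero (B : Fin a → Module.End R (Finset (Fin a) → R))
    (h0 : ∀ i f, B i (B i f) = 0) (h1 : ∀ i j, i ≠ j → ∀ f, B i (B j f) = - B j (B i f))
    (v w : Fin a → R) (f : Finset (Fin a) → R) :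
    (∑ i, v i • B i (∑ j, w j • B j f)) + ∑ i, w i • B i (∑ j, v j • B j f) = 0 := by
  simp only [map_sum, map_smul, Finset.smul_sum, smul_smul]
  rw [Finset.sum_comm (f := fun i j => (w i * v j) • B i (B j f)), ← Finset.sum_add_distrib]
  refine Finset.sum_eq_zero fun i _ => ?_
  rw [← Finset.sum_add_distrib]
  refine Finset.sum_eq_zero fun j _ => ?_
  by_cases h : i = j
  · subst h; simp [h0]
  · rw [h1 i j h, smul_neg, mul_comm (w j)]; simp

theorem wedge_anticomm (v w : Fin a → R) (f : Finset (Fin a) → R) :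
    wedge R a v (wedge R a w f) = - wedge R a w (wedge R a v f) := by
  rw [eq_neg_iff_add_eq_zero]
  simp only [wedge_apply]
  exact sum_anticomm_eq_zero _ wedgeBasis_wedgeBasis_self
    (fun i j h f => wedgeBasis_anticomm h f) v w f

theorem sum_square_eq_zero (B : Fin a → Module.End R (Finset (Fin a) → R))
    (h0 : ∀ i f, B i (B i f) = 0) (h1 : ∀ i j, i ≠ j → ∀ f, B i (B j f) = - B j (B i f))
    (v : Fin a → R) (f : Finset (Fin a) → R) :
    (∑ i, v i • B i (∑ j, v j • B j f)) = 0 := by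
  simp only [map_sum, map_smul, Finset.smul_sum, smul_smul]
  rw [← Finset.sum_product']
  refine Finset.sum_involution (fun x _ => (x.2, x.1)) ?_ ?_ ?_ ?_
  · rintro ⟨i, j⟩ -
    by_cases h : i = j
    · subst h; simp [h0]
    · simp only [h1 i j h, smul_neg, mul_comm (v j)]; simp
  · rintro ⟨i, j⟩ - hne heq
    have : i = j := by simpa using (congrArg Prod.snd heq)
    subst this
    simp [h0] at hne
  · simp
  · simp

theorem contract_contract_self (v : Fin a → R) (f : Finset (Fin a) → R) :
    contract R a v (contract R a v f) = 0 := by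
  simp only [contract_apply]
  exact sum_square_eq_zero _ contractBasis_contractBasis_self
    (fun i j h f => contractBasis_anticomm h f) v f

theorem wedge_wedge_self (v : Fin a → R) (f : Finset (Fin a) → R) :
    wedge R a v (wedge R a v f) = 0 := by
  simp only [wedge_apply]
  exact sum_square_eq_zero _ wedgeBasis_wedgeBasis_self
    (fun i j h f => wedgeBasis_anticomm h f) v f

/-- The canonical anticommutation relation. -/
theorem contract_wedge (ξ v : Fin a → R) (f : Finset (Fin a) → R) :
    contract R a ξ (wedge R a v f) + wedge R a v (contract R a ξ f) = (ξ ⬝ᵥ v) • f := by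
  simp only [contract_apply, wedge_apply, map_sum, map_smul, Finset.smul_sum, smul_smul]
  rw [Finset.sum_comm (f := fun i j => (v i * ξ j) • contractBasis R j (wedgeBasis R i f)),
    ← Finset.sum_add_distrib, dotProduct, Finset.sum_smul]
  refine Finset.sum_congr rfl fun i _ => ?_
  rw [← Finset.sum_add_distrib, Finset.sum_eq_single i]
  · rw [mul_comm (v i), ← smul_add, contractBasis_wedgeBasis_self]
  · intro j _ hj
    rw [mul_comm (v j), ← smul_add, contractBasis_wedgeBasis_of_ne hj.symm, smul_zero]
  · simp

theorem wedge_apply_singleton (v : Fin a → R) (f : Finset (Fin a) → R) (i : Fin a) :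
    wedge R a v f {i} = v i * f ∅ := by
  rw [wedge_apply, Finset.sum_apply, Finset.sum_eq_single i]
  · simp [wedgeBasis_apply, wedgeSign]
  · intro j _ hj
    simp [wedgeBasis_apply, hj]
  · simp

theorem wedge_apply_empty (v : Fin a → R) (f : Finset (Fin a) → R) :
    wedge R a v f ∅ = 0 := by
  rw [wedge_apply, Finset.sum_apply]
  exact Finset.sum_eq_zero fun i _ => by simp [wedgeBasis_apply]

/-- Successive contraction with the covectors `ξ 0, …, ξ (k - 1)`, the last one first. -/
def contractMulti (R : Type*) [CommRing R] (a k : ℕ) :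
    (Fin a → R) [⋀^Fin k]→ₗ[R] Module.End R (Finset (Fin a) → R) :=
  (ExteriorAlgebra.lift R ⟨contract R a, fun v => LinearMap.ext fun f =>
    contract_contract_self v f⟩).toLinearMap.compAlternatingMap (ExteriorAlgebra.ιMulti R k)

theorem contractMulti_zero (ξ : Fin 0 → Fin a → R) : contractMulti R a 0 ξ = 1 := by
  simp [contractMulti]

theorem contractMulti_succ {k : ℕ} (ξ : Fin (k + 1) → Fin a → R) (f : Finset (Fin a) → R) :
    contractMulti R a (k + 1) ξ f =
      contract R a (ξ 0) (contractMulti R a k (Matrix.vecTail ξ) f) := by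
  simp [contractMulti, ExteriorAlgebra.ιMulti_succ_apply]

theorem contract_map {A B : Type*} [CommRing A] [CommRing B] (h : A →+* B) (ξ : Fin a → A)
    (f : Finset (Fin a) → A) (Q : Finset (Fin a)) :
    h (contract A a ξ f Q) = contract B a (h ∘ ξ) (h ∘ f) Q := by
  simp only [contract_apply, Finset.sum_apply, map_sum, Pi.smul_apply, smul_eq_mul, map_mul,
    Function.comp]
  refine Finset.sum_congr rfl fun i _ => ?_
  by_cases hi : i ∈ Q <;> simp [contractBasis_apply, hi, wedgeSign]

theorem wedge_map {A B : Type*} [CommRing A] [CommRing B] (h : A →+* B) (v : Fin a → A)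
    (f : Finset (Fin a) → A) (S : Finset (Fin a)) :
    h (wedge A a v f S) = wedge B a (h ∘ v) (h ∘ f) S := by
  simp only [wedge_apply, Finset.sum_apply, map_sum, Pi.smul_apply, smul_eq_mul, map_mul,
    Function.comp]
  refine Finset.sum_congr rfl fun i _ => ?_
  by_cases hi : i ∈ S <;> simp [wedgeBasis_apply, hi, wedgeSign]

theorem contractMulti_map {A B : Type*} [CommRing A] [CommRing B] (h : A →+* B) {k : ℕ}
    (ξ : Fin k → Fin a → A) (f : Finset (Fin a) → A) (Q : Finset (Fin a)) :
    h (contractMulti A a k ξ f Q) = contractMulti B a k (fun t => h ∘ ξ t) (h ∘ f) Q := by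
  induction k generalizing Q with
  | zero => simp [contractMulti_zero]
  | succ k ih =>
    rw [contractMulti_succ, contractMulti_succ, contract_map]
    have : h ∘ contractMulti A a k (Matrix.vecTail ξ) f =
        contractMulti B a k (Matrix.vecTail fun t => h ∘ ξ t) (h ∘ f) :=
      funext fun Q' => ih (Matrix.vecTail ξ) Q'
    rw [this]

/-- Contractions with covectors that annihilate all `u j` commute, up to sign, with the exterior
products by the `u j`. -/
theorem sum_wedge_contractMulti {β : Type*} [Fintype β] {k : ℕ} (u : β → Fin a → R)
    (W : β → Finset (Fin a) → R) (hW : ∑ j, wedge R a (u j) (W j) = 0)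
    (ξ : Fin k → Fin a → R) (hξ : ∀ t j, ξ t ⬝ᵥ u j = 0) :
    ∑ j, wedge R a (u j) (contractMulti R a k ξ (W j)) = 0 := by
  induction k with
  | zero => simpa [contractMulti_zero] using hW
  | succ k ih =>
    have h := ih (Matrix.vecTail ξ) (fun t j => hξ t.succ j)
    have h2 := congrArg (contract R a (ξ 0)) h
    rw [map_sum, map_zero] at h2
    rw [← neg_eq_zero, ← Finset.sum_neg_distrib, ← h2]
    refine Finset.sum_congr rfl fun j _ => ?_
    rw [contractMulti_succ, neg_eq_iff_add_eq_zero, add_comm, contract_wedge, hξ, zero_smul]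

/-- A form all of whose contractions of order `k` by members of `Ξ` vanish on subsets of `K`
vanishes on `K`, if the members of `Ξ` separate the vectors with support in `K`. -/
theorem eq_zero_of_contractMulti_eq_zero {K : Finset (Fin a)} {Ξ : Set (Fin a → R)}
    (hΞ : ∀ h : Fin a → R, (∀ ξ ∈ Ξ, ξ ⬝ᵥ h = 0) → ∀ i ∈ K, h i = 0) {k l : ℕ}
    (f : Finset (Fin a) → R)
    (hf : ∀ ξ : Fin k → Fin a → R, (∀ t, ξ t ∈ Ξ) → ∀ Q ⊆ K, Q.card = l →
      contractMulti R a k ξ f Q = 0) (S : Finset (Fin a)) (hS : S ⊆ K) (hc : S.card = l + k) :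
    f S = 0 := by
  induction k generalizing l with
  | zero => simpa [contractMulti_zero] using hf Fin.elim0 (fun t => t.elim0) S hS hc
  | succ k ih =>
    refine ih (l := l + 1) (fun ξ hξ S hS hc => ?_) (by omega)
    obtain ⟨i, hi⟩ : S.Nonempty := Finset.card_pos.1 (by omega)
    set Q := S.erase i with hQ
    have key := hΞ (fun i => contractBasis R i (contractMulti R a k ξ f) Q) ?_ i (hS hi)
    · have h3 : wedgeSign R Q i * contractMulti R a k ξ f S = 0 := by
        simpa [contractBasis_apply, hQ, Finset.insert_erase hi] using key
      have := congrArg (wedgeSign R Q i * ·) h3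
      simpa [← mul_assoc, wedgeSign_mul_self] using this
    · intro η hη
      have := hf (Matrix.vecCons η ξ) (Fin.cases hη hξ) Q ((Finset.erase_subset _ _).trans hS)
        (by rw [hQ, Finset.card_erase_of_mem hi]; omega)
      rw [contractMulti_succ, contract_apply, Finset.sum_apply] at this
      simpa [dotProduct] using this

end Operators

/-! ### The Young flattening and its rank -/

section Flattening

variable {R : Type*} [CommRing R] {a b c : ℕ}

/-- The form of degree `p` with the given coordinates, as an element of the whole exterior
algebra: its coordinates in all other degrees are zero. -/
def extendForm {p : ℕ} (W : WedgeIndex a p → R) : Finset (Fin a) → R :=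
  fun S => if h : S.card = p then W ⟨S, h⟩ else 0

theorem extendForm_of_card_ne {p : ℕ} (W : WedgeIndex a p → R) {S : Finset (Fin a)}
    (h : S.card ≠ p) : extendForm W S = 0 := dif_neg h

theorem extendForm_coe {p : ℕ} (W : WedgeIndex a p → R) (Q : WedgeIndex a p) :
    extendForm W Q.1 = W Q := dif_pos Q.2

theorem wedgeBasis_extendForm {p : ℕ} (W : WedgeIndex a p → R) (i : Fin a)
    (S : WedgeIndex a (p + 1)) :
    wedgeBasis R i (extendForm W) S.1 = ∑ Q : WedgeIndex a p, (wedgeCoeff Q.1 i S.1 : R) * W Q := by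
  rw [wedgeBasis_apply]
  split_ifs with hi
  · have hc : (S.1.erase i).card = p := by rw [Finset.card_erase_of_mem hi, S.2]; rfl
    rw [Finset.sum_eq_single ⟨S.1.erase i, hc⟩]
    · simp [wedgeCoeff, Finset.insert_erase hi, extendForm, hc, wedgeSign]
    · intro Q _ hQ
      have : ¬ (i ∉ Q.1 ∧ S.1 = insert i Q.1) := by
        rintro ⟨h1, h2⟩
        exact hQ (Subtype.ext (by simp [h2, h1]))
      simp only [wedgeCoeff, if_neg this]; simp
    · simp
  · rw [eq_comm]
    refine Finset.sum_eq_zero fun Q _ => ?_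
    have : ¬ (i ∉ Q.1 ∧ S.1 = insert i Q.1) := by
      rintro ⟨h1, h2⟩
      exact hi (by simp [h2])
    simp only [wedgeCoeff, if_neg this]; simp

/-- The Young flattening in terms of exterior products. -/
theorem youngFlattening_mulVec {p : ℕ} (T : Tensor3 R a b c) (W : WedgeIndex a p × Fin b → R)
    (x : WedgeIndex a (p + 1) × Fin c) :
    (youngFlattening p T).mulVec W x =
      ∑ j, wedge R a (fun i => T i j x.2) (extendForm fun Q => W (Q, j)) x.1.1 := by
  simp only [Matrix.mulVec, dotProduct, youngFlattening, wedge_apply, Finset.sum_apply,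
    Pi.smul_apply, smul_eq_mul, wedgeBasis_extendForm, Finset.mul_sum, Finset.sum_mul]
  rw [Fintype.sum_prod_type_right]
  refine Finset.sum_congr rfl fun j _ => ?_
  rw [Finset.sum_comm]
  refine Finset.sum_congr rfl fun i _ => Finset.sum_congr rfl fun Q _ => ?_
  ring

theorem wedge_apply_of_card_ne {p : ℕ} {f : Finset (Fin a) → R} (hf : ∀ S, S.card ≠ p → f S = 0)
    (v : Fin a → R) (S : Finset (Fin a)) (hS : S.card ≠ p + 1) : wedge R a v f S = 0 := by
  rw [wedge_apply, Finset.sum_apply]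
  refine Finset.sum_eq_zero fun i _ => ?_
  rw [Pi.smul_apply, wedgeBasis_apply]
  split_ifs with hi
  · rw [hf _ (by rw [Finset.card_erase_of_mem hi]; have := Finset.card_pos.2 ⟨i, hi⟩; omega)]
    simp
  · simp

end Flattening

section RankBound

variable {a b c : ℕ}

theorem card_subset_avoiding (i : Fin a) (p : ℕ) :
    Fintype.card {Q : Finset (Fin a) // Q.card = p ∧ i ∉ Q} = (a - 1).choose p := by
  rw [Fintype.card_subtype]
  have : (Finset.univ.filter fun Q : Finset (Fin a) => Q.card = p ∧ i ∉ Q) =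
      (Finset.univ.erase i).powersetCard p := by
    ext Q
    simp only [Finset.mem_filter, Finset.mem_univ, true_and, Finset.mem_powersetCard,
      Finset.subset_erase, Finset.subset_univ]
    tauto
  rw [this, Finset.card_powersetCard, Finset.card_erase_of_mem (Finset.mem_univ i)]
  simp

/-- Since `u ∧ u = 0`, every product `ω ∧ u` is the product of `u` with a form that does not
involve a given basis vector occurring in `u`. -/
theorem exists_wedge_eq_avoiding {p : ℕ} (u : Fin a → ℂ) (i : Fin a) (hi : u ≠ 0 → u i ≠ 0)
    (f : Finset (Fin a) → ℂ) (hf : ∀ S, S.card ≠ p → f S = 0) :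
    ∃ h : Finset (Fin a) → ℂ, (∀ Q, ¬ (Q.card = p ∧ i ∉ Q) → h Q = 0) ∧
      wedge ℂ a u h = wedge ℂ a u f := by
  by_cases hu : u = 0
  · exact ⟨0, fun _ _ => rfl, by simp [hu]⟩
  set g := wedge ℂ a u f
  have hg : ∀ S, S.card ≠ p + 1 → g S = 0 := wedge_apply_of_card_ne hf u
  refine ⟨contract ℂ a (Pi.single i (u i)⁻¹) g, fun Q hQ => ?_, ?_⟩
  · rw [contract_apply, Finset.sum_apply]
    refine Finset.sum_eq_zero fun j _ => ?_
    by_cases hj : j = i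
    · subst hj
      rw [Pi.smul_apply, contractBasis_apply]
      split_ifs with h
      · simp
      · rw [hg _ (by rw [Finset.card_insert_of_notMem h]; exact fun hc => hQ ⟨by omega, h⟩)]
        simp
    · simp [hj]
  · have h1 := congrArg (wedge ℂ a u) (contract_wedge (Pi.single i (u i)⁻¹) u f)
    rw [map_add, wedge_wedge_self, add_zero, single_dotProduct, inv_mul_cancel₀ (hi hu),
      one_smul] at h1
    exact h1

/-- By `exists_wedge_eq_avoiding`, a tensor of rank one has a Young flattening of rank at
most `(a - 1).choose p`; so a sum of `r` of them has one of rank at most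
`r * (a - 1).choose p`. -/
theorem rank_youngFlattening_le {r p : ℕ} (ha : 0 < a) {T : Tensor3 ℂ a b c}
    (hT : T ∈ rankAtMost a b c r) : (youngFlattening p T).rank ≤ r * (a - 1).choose p := by
  obtain ⟨u, v, w, h⟩ := hT
  have hex : ∀ s, ∃ i, u s ≠ 0 → u s i ≠ 0 := fun s => by
    by_cases hs : u s = 0
    · exact ⟨⟨0, ha⟩, fun h => absurd hs h⟩
    · obtain ⟨i, hi⟩ := Function.ne_iff.1 hs
      exact ⟨i, fun _ => hi⟩
  choose i hi using hex
  let X := Σ s, {Q : Finset (Fin a) // Q.card = p ∧ i s ∉ Q}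
  let ext (s : Fin r) : (X → ℂ) →ₗ[ℂ] (Finset (Fin a) → ℂ) :=
    { toFun := fun g Q => if hQ : Q.card = p ∧ i s ∉ Q then g ⟨s, Q, hQ⟩ else 0
      map_add' := fun g g' => by
        ext Q; by_cases hQ : Q.card = p ∧ i s ∉ Q <;> simp [hQ]
      map_smul' := fun c g => by
        ext Q; by_cases hQ : Q.card = p ∧ i s ∉ Q <;> simp [hQ] }
  let F : (X → ℂ) →ₗ[ℂ] (WedgeIndex a (p + 1) × Fin c → ℂ) :=
    LinearMap.pi fun x => ∑ s, w s x.2 •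
      ((LinearMap.proj x.1.1 : (Finset (Fin a) → ℂ) →ₗ[ℂ] ℂ) ∘ₗ wedge ℂ a (u s) ∘ₗ ext s)
  have hsub : LinearMap.range (youngFlattening p T).mulVecLin ≤ LinearMap.range F := by
    rintro _ ⟨W, rfl⟩
    choose g hg0 hg using fun s => exists_wedge_eq_avoiding (p := p) (u s) (i s) (hi s)
      (∑ j, v s j • extendForm fun Q => W (Q, j)) (fun S hS => by
        rw [Finset.sum_apply]
        exact Finset.sum_eq_zero fun j _ => by simp [extendForm_of_card_ne _ hS])
    refine ⟨fun x => g x.1 x.2.1, ?_⟩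
    have hext : ∀ s, ext s (fun x => g x.1 x.2.1) = g s := fun s => by
      ext Q
      by_cases hQ : Q.card = p ∧ i s ∉ Q
      · simp [ext, hQ]
      · simp only [ext, LinearMap.coe_mk, AddHom.coe_mk, dif_neg hQ, hg0 s Q hQ]
    ext x
    rw [Matrix.mulVecLin_apply, youngFlattening_mulVec]
    simp only [F, LinearMap.pi_apply, LinearMap.sum_apply, LinearMap.smul_apply,
      LinearMap.comp_apply, LinearMap.proj_apply, hext, hg, map_sum, map_smul, smul_eq_mul,
      Finset.mul_sum]
    rw [Finset.sum_comm]
    refine Finset.sum_congr rfl fun j _ => ?_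
    have : (fun i => T i j x.2) = ∑ s, (w s x.2 * v s j) • u s := by
      ext i
      simp only [h, Finset.sum_apply, Pi.smul_apply, smul_eq_mul]
      exact Finset.sum_congr rfl fun s _ => by ring
    rw [this]
    simp only [map_sum, map_smul, LinearMap.sum_apply, LinearMap.smul_apply, Finset.sum_apply,
      Pi.smul_apply, smul_eq_mul]
    exact Finset.sum_congr rfl fun s _ => by ring
  calc (youngFlattening p T).rank ≤ Module.finrank ℂ (LinearMap.range F) :=
        Submodule.finrank_mono hsub
    _ ≤ Module.finrank ℂ (X → ℂ) := LinearMap.finrank_range_le F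
    _ = r * (a - 1).choose p := by
        rw [Module.finrank_pi, Fintype.card_sigma]
        simp [card_subset_avoiding]

end RankBound

/-! ### Minors of the Young flattening -/

section Minors

variable {a a' b c : ℕ}

theorem mapA_mem_rankAtMost {r : ℕ} (Φ : Matrix (Fin a') (Fin a) ℂ) {T : Tensor3 ℂ a b c}
    (hT : T ∈ rankAtMost a b c r) : T.mapA Φ ∈ rankAtMost a' b c r := by
  obtain ⟨u, v, w, h⟩ := hT
  refine ⟨fun s => Φ.mulVec (u s), v, w, fun i j k => ?_⟩
  simp only [Tensor3.mapA, h, Matrix.mulVec, dotProduct, Algebra.algebraMap_self, RingHom.id_apply,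
    Finset.mul_sum, Finset.sum_mul]
  rw [Finset.sum_comm]
  exact Finset.sum_congr rfl fun s _ => Finset.sum_congr rfl fun i _ => by ring

theorem evalAt_minor {n p : ℕ} (Φ : Matrix (Fin a') (Fin a) ℂ)
    (ρ : Fin n → WedgeIndex a' (p + 1) × Fin c) (κ : Fin n → WedgeIndex a' p × Fin b)
    (T : Tensor3 ℂ a b c) :
    TensorPoly.evalAt
        ((youngFlattening p ((genericTensor a b c).mapA Φ)).submatrix ρ κ).det T =
      ((youngFlattening p (T.mapA Φ)).submatrix ρ κ).det := by
  unfold TensorPoly.evalAt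
  rw [RingHom.map_det]
  congr 1
  ext x y
  simp [youngFlattening, Tensor3.mapA, genericTensor]

/-- The minors vanish at tensors of rank at most `r` because they are larger than the rank of the
flattening, and at the limits of such tensors by continuity. -/
theorem evalAt_eq_zero_of_mem_borderRankAtMost {r p : ℕ} (Φ : Matrix (Fin a') (Fin a) ℂ)
    (ha : 0 < a')
    (hr : r * (a' - 1).choose p < min (a'.choose (p + 1) * c) (a'.choose p * b))
    {P : TensorPoly a b c} (hP : P ∈ youngEquations Φ p) {T : Tensor3 ℂ a b c}
    (hT : T ∈ borderRankAtMost a b c r) : P.evalAt T = 0 := by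
  obtain ⟨ρ, κ, rfl⟩ := hP
  have hcl : IsClosed {T : Tensor3 ℂ a b c | TensorPoly.evalAt
      ((youngFlattening p ((genericTensor a b c).mapA Φ)).submatrix ρ κ).det T = 0} := by
    refine isClosed_eq ?_ continuous_const
    refine (MvPolynomial.continuous_eval _).comp ?_
    fun_prop
  refine closure_minimal (fun T hT => ?_) hcl hT
  rw [Set.mem_ofPred_eq, evalAt_minor]
  by_contra hdet
  have h1 := Matrix.rank_of_det_ne_zero hdet
  have h2 := Matrix.rank_submatrix_le (youngFlattening p (T.mapA Φ)) ρ κ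
  have h3 := rank_youngFlattening_le (p := p) ha (mapA_mem_rankAtMost Φ hT)
  rw [Fintype.card_fin] at h1
  omega

theorem card_wedgeIndex (a p : ℕ) : Fintype.card (WedgeIndex a p) = a.choose p := by
  rw [Fintype.card_finset_len, Fintype.card_fin]

end Minors

section MinorsVanish

variable {a a' b c : ℕ}

/-- If a matrix with at least as many rows as columns has a nontrivial kernel, its maximal minors
vanish. -/
theorem det_submatrix_eq_zero {m n : Type*} [Fintype n] {N : ℕ} (M : Matrix m n ℂ)
    (hN : N = Fintype.card n) (ρ : Fin N → m) (κ : Fin N ↪ n) {W : n → ℂ} (hW : W ≠ 0)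
    (hMW : M.mulVec W = 0) : (M.submatrix ρ κ).det = 0 := by
  have hκ : Function.Bijective κ :=
    (Fintype.bijective_iff_injective_and_card κ).2 ⟨κ.injective, by simp [hN]⟩
  rw [← Matrix.exists_mulVec_eq_zero_iff]
  refine ⟨W ∘ κ, fun h => hW ?_, ?_⟩
  · ext x
    obtain ⟨y, rfl⟩ := hκ.2 x
    exact congrFun h y
  · ext x
    have := congrFun hMW (ρ x)
    rw [Matrix.mulVec, dotProduct] at this ⊢
    rw [← (Equiv.ofBijective κ hκ).sum_comp] at this
    simpa using this

/-- A matrix with trivial kernel has a nonzero maximal minor. -/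
theorem exists_det_submatrix_ne_zero {m n : Type*} [Fintype m] [Fintype n] {N : ℕ}
    (M : Matrix m n ℂ) (hN : N = Fintype.card n) (hM : ∀ W, M.mulVec W = 0 → W = 0) :
    ∃ (ρ : Fin N ↪ m) (κ : Fin N ↪ n), (M.submatrix ρ κ).det ≠ 0 := by
  classical
  have hrank : M.rank = N := by
    rw [Matrix.rank, LinearMap.finrank_range_of_inj, Module.finrank_fintype_fun_eq_card, hN]
    rw [← LinearMap.ker_eq_bot, LinearMap.ker_eq_bot']
    exact fun W h => hM W h
  rw [Matrix.rank_eq_finrank_span_row] at hrank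
  obtain ⟨f, hf, -, hli⟩ := Submodule.exists_fun_fin_finrank_span_eq ℂ (Set.range M.row)
  choose ρ hρ using hf
  let e : Fin N ≃ Fin (Module.finrank ℂ (Submodule.span ℂ (Set.range M.row))) := finCongr hrank.symm
  let κ : Fin N ≃ n := Fintype.equivOfCardEq (by simp [hN])
  have hρi : Function.Injective ρ := fun x y h => hli.injective (by rw [← hρ, ← hρ, h])
  refine ⟨⟨ρ ∘ e, hρi.comp e.injective⟩, κ.toEmbedding, fun hdet => ?_⟩
  have hunit : IsUnit ((M.submatrix ρ id).submatrix id (e.symm.trans κ)) := by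
    rw [← Matrix.linearIndependent_rows_iff_isUnit]
    have hrow : ((M.submatrix ρ id).submatrix id (e.symm.trans κ)).row =
        fun x => LinearMap.funLeft ℂ ℂ (e.symm.trans κ) (f x) := by
      ext x y
      simp only [← hρ]
      rfl
    rw [hrow]
    exact hli.map' (LinearMap.funLeft ℂ ℂ (e.symm.trans κ))
      (LinearMap.ker_eq_bot.2 (LinearMap.funLeft_injective_of_surjective _ _ _
        (e.symm.trans κ).surjective))
  rw [Matrix.isUnit_iff_isUnit_det] at hunit
  refine hunit.ne_zero ?_
  rw [← Matrix.det_submatrix_equiv_self e]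
  convert hdet using 2
  ext x y
  simp

end MinorsVanish

theorem choose_le_choose_succ {a p : ℕ} (h : 2 * p + 1 ≤ a) : a.choose p ≤ a.choose (p + 1) := by
  refine Nat.le_of_mul_le_mul_right (c := p + 1) ?_ (by omega)
  rw [Nat.choose_succ_right_eq]
  exact Nat.mul_le_mul_left _ (by omega)

/-! ### The kernel of the Young flattening of the matrix multiplication tensor -/

section KernelVector

variable {a : ℕ}

/-- Any `n` vectors in a space of dimension `a` have a common nonzero annihilator in the exterior
power of degree `p`, if `n ≤ p ≤ a`: the product of a basis of their span with suitable basis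
vectors of the space. -/
theorem exists_wedge_eq_zero {n p : ℕ} (hnp : n ≤ p) (hpa : p ≤ a) (v : Fin n → Fin a → ℂ) :
    ∃ ω : Finset (Fin a) → ℂ, ω ≠ 0 ∧ (∀ S, S.card ≠ p → ω S = 0) ∧
      ∀ i, wedge ℂ a (v i) ω = 0 := by
  have hprod : ∀ k ≤ n, ∃ d ≤ k, ∃ ω : Finset (Fin a) → ℂ, ω ≠ 0 ∧
      (∀ S, S.card ≠ d → ω S = 0) ∧ ∀ i : Fin n, (i : ℕ) < k → wedge ℂ a (v i) ω = 0 := by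
    intro k
    induction k with
    | zero =>
      intro _
      refine ⟨0, le_rfl, Pi.single ∅ 1, fun h => ?_, fun S hS => ?_, by simp⟩
      · simpa using congrFun h ∅
      · rw [Pi.single_eq_of_ne]; rintro rfl; exact hS rfl
    | succ k ih =>
      intro hk
      obtain ⟨d, hd, ω, h0, hc, hv⟩ := ih (by omega)
      by_cases hz : wedge ℂ a (v ⟨k, hk⟩) ω = 0
      · refine ⟨d, by omega, ω, h0, hc, fun i hi => ?_⟩
        rcases Nat.lt_succ_iff_lt_or_eq.1 hi with h | h
        · exact hv i h
        · obtain rfl : i = ⟨k, hk⟩ := Fin.ext h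
          exact hz
      · refine ⟨d + 1, by omega, _, hz, wedge_apply_of_card_ne hc _, fun i hi => ?_⟩
        rcases Nat.lt_succ_iff_lt_or_eq.1 hi with h | h
        · rw [wedge_anticomm, hv i h, map_zero, neg_zero]
        · obtain rfl : i = ⟨k, hk⟩ := Fin.ext h
          exact wedge_wedge_self _ _
  obtain ⟨d, hd, ω, h0, hc, hv⟩ := hprod n le_rfl
  have hraise : ∀ e, d + e ≤ a → ∃ ω : Finset (Fin a) → ℂ, ω ≠ 0 ∧
      (∀ S, S.card ≠ d + e → ω S = 0) ∧ ∀ i : Fin n, wedge ℂ a (v i) ω = 0 := by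
    intro e
    induction e with
    | zero => exact fun _ => ⟨ω, h0, hc, fun i => hv i i.2⟩
    | succ e ih =>
      intro he
      obtain ⟨ω, h0, hc, hv⟩ := ih (by omega)
      obtain ⟨Q, hQ⟩ := Function.ne_iff.1 h0
      have hQc : Q.card = d + e := by by_contra h; exact hQ (hc Q h)
      obtain ⟨i, -, hi⟩ : ∃ i ∈ (Finset.univ : Finset (Fin a)), i ∉ Q :=
        Finset.exists_mem_notMem_of_card_lt_card (by simp; omega)
      refine ⟨wedge ℂ a (Pi.single i 1) ω, fun h => hQ ?_, wedge_apply_of_card_ne hc _,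
        fun j => by rw [wedge_anticomm, hv, map_zero, neg_zero]⟩
      have h1 := congrFun h (insert i Q)
      rw [wedge_apply, Finset.sum_apply, Finset.sum_eq_single i] at h1
      · rw [Pi.single_eq_same, one_smul, wedgeBasis_insert hi] at h1
        have := congrArg (wedgeSign ℂ Q i * ·) h1
        simpa [← mul_assoc, wedgeSign_mul_self] using this
      · intro j _ hj; simp [hj]
      · simp
  obtain ⟨ω, h⟩ := hraise (p - d) (by omega)
  rw [show d + (p - d) = p by omega] at h
  exact ⟨ω, h⟩

theorem matMulTensor_apply (n : ℕ) (i j j' l : Fin n) (z : Fin (n * n)) :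
    matMulTensor n (finProdFinEquiv (i, j)) (finProdFinEquiv (j', l)) z =
      if j = j' ∧ z = finProdFinEquiv (i, l) then 1 else 0 := by
  obtain ⟨⟨x, y⟩, rfl⟩ := finProdFinEquiv.surjective z
  simp only [matMulTensor, Equiv.symm_apply_apply, EmbeddingLike.apply_eq_iff_eq, Prod.mk.injEq]
  by_cases h : j = j'
  · subst h
    rw [Matrix.single_mul_single_same, Matrix.single_apply]
    simp [eq_comm]
  · rw [Matrix.single_mul_single_of_ne _ _ _ _ h]
    simp [h]

/-- A Young flattening of `M_n` has a nontrivial kernel: the slice of `M_n` at a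
coordinate of the second factor only involves `n` vectors of the first one, and there is a form of
degree `p ≥ n` divisible by all of them. -/
theorem evalAt_matMulTensor_eq_zero {n p : ℕ} (hn : 0 < n) (hnp : n ≤ p) (hpa : 2 * p + 1 ≤ a)
    (Φ : Matrix (Fin a) (Fin (n * n)) ℂ) {P : TensorPoly (n * n) (n * n) (n * n)}
    (hP : P ∈ youngEquations Φ p) : P.evalAt (matMulTensor n) = 0 := by
  obtain ⟨ρ, κ, rfl⟩ := hP
  rw [evalAt_minor]
  set j₀ : Fin n := ⟨0, hn⟩
  obtain ⟨ω, h0, hc, hv⟩ := exists_wedge_eq_zero hnp (by omega : p ≤ a)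
    (fun i i' => Φ i' (finProdFinEquiv (i, j₀)))
  set y₀ : Fin (n * n) := finProdFinEquiv (j₀, j₀)
  have hext : ∀ j, extendForm (fun Q : WedgeIndex a p => if j = y₀ then ω Q.1 else 0) =
      if j = y₀ then ω else 0 := by
    intro j
    ext S
    by_cases hS : S.card = p
    · rw [extendForm, dif_pos hS]; split_ifs <;> rfl
    · rw [extendForm_of_card_ne _ hS]; split_ifs
      · exact (hc S hS).symm
      · rfl
  refine det_submatrix_eq_zero (W := fun x => if x.2 = y₀ then ω x.1.1 else 0) _ ?_ ρ κ ?_ ?_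
  · rw [Fintype.card_prod, card_wedgeIndex, Fintype.card_fin]
    refine min_eq_right (Nat.mul_le_mul_right _ ?_)
    exact choose_le_choose_succ hpa
  · obtain ⟨Q, hQ⟩ := Function.ne_iff.1 h0
    have hQc : Q.card = p := by by_contra h; exact hQ (hc Q h)
    exact Function.ne_iff.2 ⟨(⟨Q, hQc⟩, y₀), by simpa using hQ⟩
  · ext x
    rw [youngFlattening_mulVec, Finset.sum_eq_single y₀]
    · change wedge ℂ a _ (extendForm fun Q : WedgeIndex a p => if y₀ = y₀ then ω Q.1 else 0) _ = 0
      rw [hext, if_pos rfl]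
      obtain ⟨⟨i, l⟩, hz⟩ := finProdFinEquiv.surjective x.2
      have : (fun i' => Tensor3.mapA Φ (matMulTensor n) i' y₀ x.2) =
          if l = j₀ then (fun i' => Φ i' (finProdFinEquiv (i, j₀))) else 0 := by
        ext i'
        simp only [Tensor3.mapA]
        rw [← finProdFinEquiv.sum_comp, Fintype.sum_prod_type]
        simp only [y₀, matMulTensor_apply, ← hz, EmbeddingLike.apply_eq_iff_eq, Prod.mk.injEq]
        by_cases hl : l = j₀
        · simp [hl, ite_and, Finset.sum_ite_eq]
        · simp [hl]
      rw [this]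
      split_ifs
      · rw [hv]; rfl
      · simp
    · intro j _ hj
      change wedge ℂ a _ (extendForm fun Q : WedgeIndex a p => if j = y₀ then ω Q.1 else 0) _ = 0
      rw [hext, if_neg hj, map_zero]
      rfl
    · simp

end KernelVector

/-! ### Reduction to one tensor with injective flattening -/

section Reduction

variable {a a' : ℕ}

/-- The Young flattening `Λ^p A ⊗ B^* → Λ^{p+1} A ⊗ C` of a tensor, with `B` and `C` based on
arbitrary finite types, is injective. An element of `Λ^p A ⊗ B^*` is encoded as a family of forms
indexed by the basis of `B^*`. -/
def FlatteningInjective {β γ : Type*} [Fintype β] (p : ℕ) (T : Fin a → β → γ → ℂ) : Prop :=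
  ∀ W : β → Finset (Fin a) → ℂ, (∀ j S, S.card ≠ p → W j S = 0) →
    (∀ k, ∑ j, wedge ℂ a (fun i => T i j k) (W j) = 0) → W = 0

/-- The kernel condition of the flattening after extension of scalars to `A` and pairing of `C`
with an element `g` of its dual. -/
theorem sum_wedge_sum_mul_eq_zero {β γ A : Type*} [Fintype β] [Fintype γ] [CommRing A]
    [Algebra ℂ A] {T : Fin a → β → γ → ℂ} {W : β → Finset (Fin a) → ℂ}
    (hW : ∀ k, ∑ j, wedge ℂ a (fun i => T i j k) (W j) = 0) (g : γ → A) :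
    ∑ j, wedge A a (fun i => ∑ k, g k * algebraMap ℂ A (T i j k)) (algebraMap ℂ A ∘ W j) = 0 := by
  have h1 : ∀ j, wedge A a (fun i => ∑ k, g k * algebraMap ℂ A (T i j k))
      (algebraMap ℂ A ∘ W j) = ∑ k, g k •
        (algebraMap ℂ A ∘ wedge ℂ a (fun i => T i j k) (W j)) := fun j => by
    rw [show (fun i => ∑ k, g k * algebraMap ℂ A (T i j k)) =
      ∑ k, g k • (algebraMap ℂ A ∘ fun i => T i j k) by ext i; simp, map_sum]
    simp only [map_smul, LinearMap.sum_apply, LinearMap.smul_apply]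
    refine Finset.sum_congr rfl fun k _ => ?_
    congr 1
    ext S
    exact (wedge_map (algebraMap ℂ A) _ _ S).symm
  simp only [h1]
  rw [Finset.sum_comm]
  refine Finset.sum_eq_zero fun k _ => ?_
  rw [← Finset.smul_sum]
  ext S
  have := congrArg (algebraMap ℂ A) (congrFun (hW k) S)
  simp only [Finset.sum_apply, map_sum, Pi.zero_apply, map_zero] at this
  simp [this]

theorem FlatteningInjective.reindex {β γ : Type*} [Fintype β] {p b c : ℕ} {T : Fin a → β → γ → ℂ}
    (hT : FlatteningInjective p T) (eβ : β ≃ Fin b) (eγ : γ ≃ Fin c)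
    (W : WedgeIndex a p × Fin b → ℂ)
    (hW : (youngFlattening p (fun i j k => T i (eβ.symm j) (eγ.symm k))).mulVec W = 0) :
    W = 0 := by
  have h := hT (fun j => extendForm fun Q => W (Q, eβ j))
    (fun j S hS => extendForm_of_card_ne _ hS) (fun k => ?_)
  · ext ⟨Q, j⟩
    have := congrFun (congrFun h (eβ.symm j)) Q.1
    rw [extendForm_coe] at this
    simpa using this
  · ext S
    by_cases hS : S.card = p + 1
    · have := congrFun hW (⟨S, hS⟩, eγ k)
      rw [youngFlattening_mulVec, ← eβ.sum_comp] at this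
      simpa using this
    · rw [Finset.sum_apply]
      exact Finset.sum_eq_zero fun j _ =>
        wedge_apply_of_card_ne (fun S hS => extendForm_of_card_ne _ hS) _ S hS

theorem exists_mapA_eq {b c : ℕ} {Φ : Matrix (Fin a') (Fin a) ℂ} (hΦ : Φ.rank = a')
    (T : Tensor3 ℂ a' b c) : ∃ T' : Tensor3 ℂ a b c, T'.mapA Φ = T := by
  have hsurj : Function.Surjective Φ.mulVec := by
    have : LinearMap.range Φ.mulVecLin = ⊤ := by
      apply Submodule.eq_top_of_finrank_eq
      rw [Module.finrank_fintype_fun_eq_card, Fintype.card_fin]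
      exact hΦ
    exact LinearMap.range_eq_top.1 this
  choose x hx using fun j k => hsurj (fun i => T i j k)
  refine ⟨fun i j k => x j k i, ?_⟩
  ext i j k
  have := congrFun (hx j k) i
  simpa [Tensor3.mapA, Matrix.mulVec, dotProduct] using this

/-- The maximal minors are nontrivial equations as soon as the size of the flattening exceeds the
bound on its rank and one tensor has an injective flattening. -/
theorem nontrivialEquations_of_flatteningInjective {β γ : Type*} [Fintype β] {p m r : ℕ}
    {Φ : Matrix (Fin a') (Fin a) ℂ} (hΦ : Φ.rank = a') (hp : 2 * p + 1 ≤ a')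
    (hr : r * (a' - 1).choose p < a'.choose p * m) {T : Fin a' → β → γ → ℂ}
    (hT : FlatteningInjective p T) (eβ : β ≃ Fin m) (eγ : γ ≃ Fin m) :
    NontrivialEquations (b := m) (c := m) r (youngEquations Φ p) := by
  have hmin : min (a'.choose (p + 1) * m) (a'.choose p * m) = a'.choose p * m :=
    min_eq_right (Nat.mul_le_mul_right _ (choose_le_choose_succ hp))
  refine ⟨fun P hP T hT => evalAt_eq_zero_of_mem_borderRankAtMost Φ (by omega)
    (by rwa [hmin]) hP hT, ?_⟩
  obtain ⟨T', hT'⟩ := exists_mapA_eq hΦ (fun i j k => T i (eβ.symm j) (eγ.symm k))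
  obtain ⟨ρ, κ, hdet⟩ := exists_det_submatrix_ne_zero
    (N := min (a'.choose (p + 1) * m) (a'.choose p * m)) _
    (by rw [hmin, Fintype.card_prod, card_wedgeIndex, Fintype.card_fin]) (hT.reindex eβ eγ)
  refine ⟨_, ⟨ρ, κ, rfl⟩, fun h => hdet ?_⟩
  have := evalAt_minor Φ ρ κ T'
  rw [h, hT'] at this
  rw [← this]
  simp [TensorPoly.evalAt]

end Reduction

/-! ### The Hankel tensor -/

section Hankel

open Polynomial

variable {A : Type*} [CommRing A]

/-- The polynomial with the given roots. -/
noncomputable def nodal {k : ℕ} (x : Fin k → A) : A[X] := ∏ t, (X - C (x t))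

theorem nodal_monic {k : ℕ} (x : Fin k → A) : (nodal x).Monic :=
  monic_prod_of_monic _ _ fun t _ => monic_X_sub_C (x t)

theorem nodal_natDegree [Nontrivial A] {k : ℕ} (x : Fin k → A) : (nodal x).natDegree = k := by
  rw [nodal, natDegree_prod_of_monic _ _ fun t _ => monic_X_sub_C (x t)]
  simp

theorem eval_nodal {k : ℕ} (x : Fin k → A) (y : A) : (nodal x).eval y = ∏ t, (y - x t) := by
  simp [nodal, eval_prod]

theorem eval_nodal_self {k : ℕ} (x : Fin k → A) (t : Fin k) : (nodal x).eval (x t) = 0 := by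
  rw [eval_nodal]
  exact Finset.prod_eq_zero (Finset.mem_univ t) (sub_self _)

/-- A covector that agrees with the powers of `x` evaluates polynomials at `x`. -/
theorem dotProduct_coeff {a d : ℕ} (hda : d ≤ a) {ξ : Fin a → A} {x : A}
    (hξ : ∀ i : Fin a, (i : ℕ) < d → ξ i = x ^ (i : ℕ)) {f : A[X]} (hf : f.natDegree < d) :
    (ξ ⬝ᵥ fun i => f.coeff i) = f.eval x := by
  rw [eval_eq_sum_range' (hf.trans_le hda), dotProduct, ← Fin.sum_univ_eq_sum_range
    (fun i => f.coeff i * x ^ i)]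
  refine Finset.sum_congr rfl fun i _ => ?_
  by_cases hi : (i : ℕ) < d
  · rw [hξ i hi, mul_comm]
  · rw [coeff_eq_zero_of_natDegree_lt (by omega)]; simp

theorem sum_coeff_mul_ite {N : ℕ} {q : A[X]} (hq : q.natDegree < N) (i j : ℕ) :
    ∑ k : Fin N, q.coeff k * (if i = j + k then 1 else 0) = (X ^ j * q).coeff i := by
  rw [coeff_X_pow_mul']
  split_ifs with h
  · obtain ⟨l, rfl⟩ := Nat.exists_eq_add_of_le h
    simp only [add_right_inj, Nat.add_sub_cancel_left]
    by_cases hl : l < N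
    · rw [Finset.sum_eq_single ⟨l, hl⟩]
      · simp
      · intro k _ hk
        rw [if_neg (fun h => hk (Fin.ext h.symm)), mul_zero]
      · simp
    · rw [coeff_eq_zero_of_natDegree_lt (by omega)]
      refine Finset.sum_eq_zero fun k _ => ?_
      rw [if_neg (by omega), mul_zero]
  · refine Finset.sum_eq_zero fun k _ => ?_
    rw [if_neg (by omega), mul_zero]

theorem natDegree_X_pow_mul_nodal_lt [Nontrivial A] {k : ℕ} (x : Fin k → A) (j : ℕ) {d : ℕ}
    (h : j + k < d) : (X ^ j * nodal x).natDegree < d := by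
  rw [natDegree_X_pow_mul, nodal_natDegree]
  · omega
  · exact (nodal_monic x).ne_zero

/-- The polynomials `X ^ j * nodal x` of degree less than `d` are linearly independent. -/
theorem eq_zero_of_sum_coeff_X_pow_mul_nodal [IsDomain A] {k N d : ℕ} (x : Fin k → A)
    (w : Fin N → A) (hd : N + k ≤ d)
    (h : ∀ i < d, ∑ j : Fin N, (X ^ (j : ℕ) * nodal x).coeff i * w j = 0) : w = 0 := by
  have h1 : (∑ j : Fin N, C (w j) * X ^ (j : ℕ)) * nodal x = 0 := by
    ext i
    rw [Finset.sum_mul, finsetSum_coeff, coeff_zero]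
    simp only [mul_assoc, coeff_C_mul]
    by_cases hi : i < d
    · rw [← h i hi]
      exact Finset.sum_congr rfl fun j _ => mul_comm _ _
    · refine Finset.sum_eq_zero fun j _ => ?_
      rw [coeff_eq_zero_of_natDegree_lt, mul_zero]
      exact natDegree_X_pow_mul_nodal_lt x j (by omega)
  have h2 := (mul_eq_zero.1 h1).resolve_right (nodal_monic x).ne_zero
  ext j
  have := congrArg (fun f => coeff f j) h2
  simp only [finsetSum_coeff, coeff_C_mul_X_pow, coeff_zero] at this
  rw [Finset.sum_eq_single j] at this
  · simpa using this
  · intro j' _ hj'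
    rw [if_neg (fun h => hj' (Fin.ext h.symm))]
  · simp

/-- Covectors of the form `(1, x, x ^ 2, …, x ^ (d - 1), *, …, *)` separate vectors. -/
theorem eq_zero_of_forall_dotProduct_geom {a d : ℕ} (h : Fin a → ℂ)
    (hh : ∀ ξ : Fin a → ℂ, (∃ x, ∀ i : Fin a, (i : ℕ) < d → ξ i = x ^ (i : ℕ)) → ξ ⬝ᵥ h = 0)
    (i : Fin a) : h i = 0 := by
  have hlarge : ∀ i : Fin a, d ≤ (i : ℕ) → h i = 0 := fun i hi => by
    have h1 := hh (fun j => (if (j : ℕ) < d then 0 ^ (j : ℕ) else 0)) ⟨0, fun j hj => by simp [hj]⟩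
    have h2 := hh
      ((fun j : Fin a => (if (j : ℕ) < d then (0 : ℂ) ^ (j : ℕ) else 0)) + Pi.single i 1)
      ⟨0, fun j hj => by
        have : j ≠ i := fun h => by subst h; omega
        simp [hj, this]⟩
    rwa [add_dotProduct, h1, zero_add, single_dotProduct, one_mul] at h2
  have hpoly : (∑ j : Fin a, C (h j) * X ^ (j : ℕ) : ℂ[X]) = 0 := by
    refine Polynomial.funext fun x => ?_
    have := hh (fun j => x ^ (j : ℕ)) ⟨x, fun _ _ => rfl⟩
    simp only [dotProduct] at this
    simp only [eval_finsetSum, eval_mul, eval_C, eval_pow, eval_X, eval_zero]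
    rw [← this]
    exact Finset.sum_congr rfl fun j _ => mul_comm _ _
  have := congrArg (fun f => coeff f i) hpoly
  simp only [finsetSum_coeff, coeff_C_mul_X_pow, coeff_zero] at this
  rw [Finset.sum_eq_single i] at this
  · simpa using this
  · intro j _ hj
    rw [if_neg (fun h => hj (Fin.ext h.symm))]
  · simp

/-- A family of forms with `∑ (X ^ j * nodal x) ∧ W j = 0` is killed by the contractions with the
evaluations at the points `x`: these annihilate all `X ^ j * nodal x`, and the polynomials
`X ^ j * nodal x` are linearly independent. -/
theorem contractMulti_eq_zero_of_sum_wedge {a k N d : ℕ} {x : Fin k → ℂ} (hd : N + k ≤ d)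
    (hda : d ≤ a) {W : Fin N → Finset (Fin a) → ℂ}
    (h : ∑ j : Fin N, wedge ℂ a (fun i => (X ^ (j : ℕ) * nodal x).coeff i) (W j) = 0)
    {ξ : Fin k → Fin a → ℂ} (hξ : ∀ t (i : Fin a), (i : ℕ) < d → ξ t i = x t ^ (i : ℕ))
    (j : Fin N) : contractMulti ℂ a k ξ (W j) ∅ = 0 := by
  have key := sum_wedge_contractMulti _ W h ξ (fun t j => by
    rw [dotProduct_coeff hda (hξ t) (natDegree_X_pow_mul_nodal_lt x j (by omega)), eval_mul,
      eval_nodal_self, mul_zero])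
  refine congrFun (eq_zero_of_sum_coeff_X_pow_mul_nodal x
    (fun j => contractMulti ℂ a k ξ (W j) ∅) hd fun i hi => ?_) j
  have := congrFun key {⟨i, by omega⟩}
  rw [Finset.sum_apply] at this
  simpa only [wedge_apply_singleton, Pi.zero_apply] using this

/-- Two copies of the multiplication of polynomials of degree at most `p`, as a tensor with
values in the polynomials of degree at most `2 * p`. -/
def hankelTensor (a p : ℕ) (i : Fin a) (j k : Bool × Fin (p + 1)) : ℂ :=
  if j.1 = k.1 then if (i : ℕ) = j.2 + k.2 then 1 else 0 else 0

/-- Polynomials of degree `p` can vanish at `p` arbitrary points; contracting an element of the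
kernel of the flattening with the evaluations at these points therefore kills it. -/
theorem flatteningInjective_hankelTensor {a p : ℕ} (ha : 2 * p + 1 ≤ a) :
    FlatteningInjective p (hankelTensor a p) := by
  intro W hdeg hW
  ext ⟨e, j⟩ S
  by_cases hS : S.card = p
  swap
  · exact hdeg _ S hS
  refine eq_zero_of_contractMulti_eq_zero (K := Finset.univ) (k := p) (l := 0)
    (Ξ := {ξ : Fin a → ℂ | ∃ x, ∀ i : Fin a, (i : ℕ) < 2 * p + 1 → ξ i = x ^ (i : ℕ)})
    (fun h hh i _ => eq_zero_of_forall_dotProduct_geom h hh i) (W (e, j)) ?_ S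
    (Finset.subset_univ S) (by omega)
  intro ξ hξ Q _ hQ
  obtain rfl := Finset.card_eq_zero.1 hQ
  choose x hx using hξ
  refine contractMulti_eq_zero_of_sum_wedge (N := p + 1) (d := 2 * p + 1) (by omega) ha
    (W := fun j => W (e, j)) ?_ hx j
  have h := sum_wedge_sum_mul_eq_zero hW
    (fun k : Bool × Fin (p + 1) => if k.1 = e then (nodal x).coeff k.2 else 0)
  rw [Fintype.sum_prod_type, Finset.sum_eq_single e] at h
  · rw [← h]
    refine Finset.sum_congr rfl fun j _ => ?_
    congr 2
    ext i
    rw [← sum_coeff_mul_ite (N := p + 1) (by rw [nodal_natDegree]; omega),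
      Fintype.sum_prod_type, Finset.sum_eq_single e]
    · simp [hankelTensor]
    · intro e' _ he'
      simp [he']
    · simp
  · intro e' _ he'
    refine Finset.sum_eq_zero fun j _ => ?_
    have h0 : (fun i => ∑ k : Bool × Fin (p + 1), (if k.1 = e then (nodal x).coeff k.2 else 0) *
        algebraMap ℂ ℂ (hankelTensor a p i (e', j) k)) = 0 := by
      ext i
      refine Finset.sum_eq_zero fun k _ => ?_
      by_cases hk : k.1 = e
      · simp [hankelTensor, hk, he']
      · simp [hk]
    rw [h0, map_zero, LinearMap.zero_apply]
  · simp

end Hankel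

/-! ### Symmetric arrays with weighted relations -/

section SymmetricArrays

open Finset

/-- Summing a function that vanishes on average along each coordinate over boxes with sides `S` or
the complement of `S`: replacing a side by the complementary one changes the sign. -/
theorem sum_piFinset_eq_neg_one_pow {n d : ℕ} (v : (Fin n → ℕ) → ℂ)
    (h : ∀ t i, ∑ a ∈ range d, v (Function.update t i a) = 0) {S : Finset ℕ} (hS : S ⊆ range d)
    {k : ℕ} (hk : k ≤ n) :
    ∑ t ∈ Fintype.piFinset (fun l : Fin n => if (l : ℕ) < k then S else range d \ S), v t =
      (-1) ^ k * ∑ t ∈ Fintype.piFinset (fun _ : Fin n => range d \ S), v t := by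
  induction k with
  | zero => simp
  | succ k ih =>
    rw [pow_succ', mul_assoc, ← ih (by omega), neg_one_mul, eq_neg_iff_add_eq_zero]
    set i : Fin n := ⟨k, hk⟩
    set G : Fin n → Finset ℕ := fun l => if (l : ℕ) < k then S else range d \ S
    have hsum : ∀ A : Finset ℕ, ∑ t ∈ Fintype.piFinset (Function.update G i A), v t =
        ∑ t ∈ Fintype.piFinset (Function.update G i {0}),
          ∑ a ∈ A, v (Function.update t i a) := by
      intro A
      rw [← sum_product']
      refine sum_nbij' (fun t => (Function.update t i 0, t i)) (fun x => Function.update x.1 i x.2)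
        ?_ ?_ ?_ ?_ ?_
      · intro t ht
        simp only [mem_product, Fintype.mem_piFinset] at ht ⊢
        refine ⟨fun l => ?_, by simpa using ht i⟩
        by_cases hl : l = i
        · subst hl; simp
        · simpa [hl] using ht l
      · rintro ⟨t, a⟩ ht
        simp only [mem_product, Fintype.mem_piFinset] at ht ⊢
        intro l
        by_cases hl : l = i
        · subst hl; simpa using ht.2
        · simpa [hl] using ht.1 l
      · intro t _; simp
      · rintro ⟨t, a⟩ ht
        simp only [mem_product, Fintype.mem_piFinset] at ht
        have := ht.1 i
        simp only [Function.update_self, mem_singleton] at this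
        simp [← this]
      · intro t _; simp
    have h1 : (fun l : Fin n => if (l : ℕ) < k + 1 then S else range d \ S) =
        Function.update G i S := by
      ext1 l
      by_cases hl : l = i
      · subst hl; simp [i]
      · have : (l : ℕ) ≠ k := fun h => hl (Fin.ext h)
        simp only [Function.update_of_ne hl, G]
        congr 1
        simp only [eq_iff_iff]; omega
    have h2 : G = Function.update G i (range d \ S) := by
      rw [eq_comm, Function.update_eq_self_iff]; simp [G, i]
    rw [h1, hsum]
    conv_lhs => rw [h2, hsum]
    simp only [Function.update_idem]
    rw [← sum_add_distrib]
    refine sum_eq_zero fun t _ => ?_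
    rw [← h t i, ← sum_sdiff hS, add_comm]

/-- A bound for a symmetric array that vanishes on average along each coordinate by its values at
the non-injective tuples: a box whose sides have fewer than `n` elements contains only those, and
a box with `n` equal sides of `n` elements contains one injective tuple up to permutations. -/
theorem norm_le_of_sum_update_eq_zero {p : ℕ} (v : (Fin (p + 1) → ℕ) → ℂ)
    (hsym : ∀ (σ : Equiv.Perm (Fin (p + 1))) t, v (t ∘ σ) = v t)
    (h : ∀ t i, ∑ a ∈ range (2 * p + 1), v (Function.update t i a) = 0) {B : ℝ} (hB0 : 0 ≤ B)
    (hB : ∀ t, ¬ Function.Injective t → ‖v t‖ ≤ B) (m : Fin (p + 1) → ℕ)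
    (hm : ∀ l, m l < 2 * p + 1) : ‖v m‖ ≤ 2 * (2 * p + 1) ^ (p + 1) * B := by
  have hpow : ∀ q : ℕ, q ≤ 2 * p + 1 → (q : ℝ) ^ (p + 1) * B ≤ (2 * p + 1) ^ (p + 1) * B :=
    fun q hq => by
      have : (q : ℝ) ≤ 2 * p + 1 := by exact_mod_cast hq
      gcongr
  have hnorm : ∀ A : Finset (Fin (p + 1) → ℕ), (∀ t ∈ A, ¬ Function.Injective t) →
      ‖∑ t ∈ A, v t‖ ≤ #A * B := fun A hA => by
    refine (norm_sum_le _ _).trans ((sum_le_card_nsmul _ _ B fun t ht => hB t (hA t ht)).trans ?_)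
    rw [nsmul_eq_mul]
  by_cases hmi : Function.Injective m
  swap
  · refine (hB m hmi).trans ?_
    have h1 : (1 : ℝ) ≤ (2 * p + 1) ^ (p + 1) := one_le_pow₀ (by
      have : (0 : ℝ) ≤ p := Nat.cast_nonneg p
      linarith)
    nlinarith
  set S : Finset ℕ := univ.image m
  have hSm : ∀ l, m l ∈ S := fun l => mem_image_of_mem m (mem_univ l)
  have hScard : #S = p + 1 := by rw [card_image_of_injective _ hmi]; simp
  have hSsub : S ⊆ range (2 * p + 1) := by
    intro a ha
    obtain ⟨l, _, rfl⟩ := mem_image.1 ha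
    exact mem_range.2 (hm l)
  have hcard : #(range (2 * p + 1) \ S) = p := by
    rw [card_sdiff_of_subset hSsub, hScard, card_range]; omega
  have key := sum_piFinset_eq_neg_one_pow v h hSsub (le_refl (p + 1))
  simp only [Fin.is_lt, if_true] at key
  have hR : ‖∑ t ∈ Fintype.piFinset (fun _ : Fin (p + 1) => S), v t‖
      ≤ (2 * p + 1) ^ (p + 1) * B := by
    rw [key, norm_mul, norm_pow, norm_neg, norm_one, one_pow, one_mul]
    refine (hnorm _ fun t ht hi => ?_).trans ?_
    · have := card_le_card_of_injOn (s := univ) t (fun l _ => Fintype.mem_piFinset.1 ht l) hi.injOn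
      rw [hcard] at this
      simp at this
    · rw [Fintype.card_piFinset, prod_const, hcard, card_univ, Fintype.card_fin, Nat.cast_pow]
      exact hpow p (by omega)
  rw [← sum_filter_add_sum_filter_not _ Function.Injective] at hR
  have hI : ∀ t ∈ (Fintype.piFinset fun _ : Fin (p + 1) => S).filter Function.Injective,
      v t = v m := by
    intro t ht
    obtain ⟨ht, hti⟩ := mem_filter.1 ht
    have : ∀ l, ∃ l', m l' = t l := fun l => by
      obtain ⟨l', _, h'⟩ := mem_image.1 (Fintype.mem_piFinset.1 ht l)
      exact ⟨l', h'⟩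
    choose σ hσ using this
    have hσi : Function.Injective σ := fun x y hxy => hti (by rw [← hσ, ← hσ, hxy])
    rw [← hsym (Equiv.ofBijective σ (Finite.injective_iff_bijective.1 hσi)) m]
    congr 1
    ext l
    exact (hσ l).symm
  rw [sum_congr rfl hI, sum_const] at hR
  have hN := hnorm ((Fintype.piFinset fun _ : Fin (p + 1) => S).filter
    (fun t => ¬ Function.Injective t)) fun t ht => (mem_filter.1 ht).2
  have hN' : (#((Fintype.piFinset fun _ : Fin (p + 1) => S).filter
      (fun t => ¬ Function.Injective t)) : ℝ) * B ≤ (2 * p + 1) ^ (p + 1) * B := by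
    refine le_trans ?_ (hpow (p + 1) (by omega))
    gcongr
    have := card_filter_le (Fintype.piFinset fun _ : Fin (p + 1) => S)
      (fun t => ¬ Function.Injective t)
    rw [Fintype.card_piFinset, prod_const, hScard, card_univ, Fintype.card_fin] at this
    exact_mod_cast this
  set c := #((Fintype.piFinset fun _ : Fin (p + 1) => S).filter Function.Injective)
  have hc : (1 : ℝ) ≤ c := by
    have : 0 < c := card_pos.2 ⟨m, mem_filter.2 ⟨Fintype.mem_piFinset.2 hSm, hmi⟩⟩
    exact_mod_cast this
  have h1 : ‖c • v m‖ ≤ 2 * (2 * p + 1) ^ (p + 1) * B := by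
    have := norm_le_add_norm_add (c • v m) (∑ t ∈ (Fintype.piFinset fun _ : Fin (p + 1) => S).filter
      (fun t => ¬ Function.Injective t), v t)
    linarith
  rw [nsmul_eq_mul, norm_mul, Complex.norm_natCast] at h1
  nlinarith [norm_nonneg (v m)]

theorem prod_comp_update_mul {n : ℕ} (s : ℕ → ℂ) (t : Fin n → ℕ) (i : Fin n) (a : ℕ) :
    (∏ l, s (Function.update t i a l)) * s (t i) = s a * ∏ l, s (t l) := by
  rw [← mul_prod_erase _ _ (mem_univ i), ← mul_prod_erase univ (fun l => s (t l)) (mem_univ i),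
    Function.update_self]
  have : ∏ l ∈ univ.erase i, s (Function.update t i a l) = ∏ l ∈ univ.erase i, s (t l) :=
    prod_congr rfl fun l hl => by rw [Function.update_of_ne (ne_of_mem_erase hl)]
  rw [this]; ring

/-- For rapidly growing weights `s`, a symmetric array with finite support in `{0, …, 2 * p} ^
(p + 1)` vanishes if all its weighted sums along a coordinate and all its alternating sums along
antidiagonals in two coordinates vanish. After rescaling by the weights, the alternating sums bound
the values at non-injective tuples by a small multiple of the maximum, and
`norm_le_of_sum_update_eq_zero` extends this to all values. -/
theorem exists_weights (p : ℕ) : ∃ s : ℕ → ℂ, ∀ v : (Fin (p + 1) → ℕ) → ℂ,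
    (∀ (σ : Equiv.Perm (Fin (p + 1))) t, v (t ∘ σ) = v t) →
    (∀ t, (∃ l, 2 * p < t l) → v t = 0) →
    (∀ t i, ∑ a ∈ range (2 * p + 1), s a * v (Function.update t i a) = 0) →
    (∀ t i j n, i ≠ j → t i = n → t j = n → ∑ x ∈ antidiagonal (2 * n),
      (-1) ^ x.1 * v (Function.update (Function.update t i x.1) j x.2) = 0) →
    ∀ t, v t = 0 := by
  -- This value makes the final estimate of the maximum `N` read `N ≤ N / 2`.
  set M : ℕ := 4 * (2 * p + 1) ^ (p + 1) * (4 * p + 1) with hM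
  have hM1 : 1 ≤ M := Nat.succ_le_of_lt (by positivity)
  have hMpos : (0 : ℝ) < M := by exact_mod_cast hM1
  refine ⟨fun a => (M : ℂ) ^ (a ^ 2), fun v hsym hsupp hsum halt => ?_⟩
  set s : ℕ → ℂ := fun a => (M : ℂ) ^ (a ^ 2) with hs
  have hs0 : ∀ a, s a ≠ 0 := fun a => pow_ne_zero _ (by exact_mod_cast (by omega : M ≠ 0))
  have hsn : ∀ a, ‖s a‖ = (M : ℝ) ^ (a ^ 2) := fun a => by simp [hs]
  set V : (Fin (p + 1) → ℕ) → ℂ := fun t => (∏ l, s (t l)) * v t with hV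
  have hVsupp : ∀ t, (∃ l, 2 * p < t l) → V t = 0 := fun t ht => by simp [hV, hsupp t ht]
  obtain ⟨t₀, -, ht₀⟩ := exists_max_image
    (Fintype.piFinset fun _ : Fin (p + 1) => range (2 * p + 1)) (fun t => ‖V t‖)
    ⟨fun _ => 0, by simp⟩
  set N := ‖V t₀‖ with hN
  have hN0 : 0 ≤ N := norm_nonneg _
  have hle : ∀ t, ‖V t‖ ≤ N := fun t => by
    by_cases h : ∃ l, 2 * p < t l
    · rw [hVsupp t h, norm_zero]; exact hN0
    · push Not at h
      exact ht₀ t (Fintype.mem_piFinset.2 fun l => mem_range.2 (Nat.lt_succ_of_le (h l)))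
  have hV2 : ∀ t i, ∑ a ∈ range (2 * p + 1), V (Function.update t i a) = 0 := fun t i => by
    refine (mul_eq_zero.1 ?_).resolve_right (hs0 (t i))
    rw [sum_mul]
    calc _ = ∑ a ∈ range (2 * p + 1), (∏ l, s (t l)) * (s a * v (Function.update t i a)) :=
          sum_congr rfl fun a _ => by
            rw [hV]; linear_combination v (Function.update t i a) * prod_comp_update_mul s t i a
      _ = 0 := by rw [← mul_sum, hsum, mul_zero]
  have hB : ∀ t, ¬ Function.Injective t → ‖V t‖ ≤ (4 * p + 1) / M * N := by
    intro t ht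
    rw [Function.not_injective_iff] at ht
    obtain ⟨i, j, hij, hne⟩ := ht
    by_cases hn : 2 * p < t i
    · rw [hVsupp t ⟨i, hn⟩, norm_zero]; positivity
    obtain ⟨n, hin⟩ : ∃ n, n = t i := ⟨_, rfl⟩
    have hjn : t j = n := by rw [hin, hij]
    have hmem : ((n, n) : ℕ × ℕ) ∈ antidiagonal (2 * n) := by simp; omega
    have h1 := halt t i j n hne hin.symm hjn
    rw [← add_sum_erase _ _ hmem] at h1
    have hupd : Function.update (Function.update t i n) j n = t := by
      conv_lhs => rw [hin]
      rw [Function.update_eq_self, hij, Function.update_eq_self]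
    simp only [hupd] at h1
    have h2 : ‖v t‖ ≤ ∑ x ∈ (antidiagonal (2 * n)).erase (n, n),
        ‖v (Function.update (Function.update t i x.1) j x.2)‖ := by
      calc ‖v t‖ = ‖(-1) ^ n * v t‖ := by simp
        _ = ‖∑ x ∈ (antidiagonal (2 * n)).erase (n, n), (-1) ^ x.1 *
            v (Function.update (Function.update t i x.1) j x.2)‖ := by
          rw [eq_neg_of_add_eq_zero_left h1, norm_neg]
        _ ≤ _ := (norm_sum_le _ _).trans (sum_le_sum fun x _ => by simp)
    have h3 : ∀ x ∈ (antidiagonal (2 * n)).erase (n, n), ‖∏ l, s (t l)‖ *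
        ‖v (Function.update (Function.update t i x.1) j x.2)‖ ≤ N / M := by
      rintro ⟨a, b⟩ hx
      obtain ⟨hx1, hx2⟩ := mem_erase.1 hx
      rw [HasAntidiagonal.mem_antidiagonal] at hx2
      simp only at hx2 ⊢
      have hab : a ≠ b := fun h => hx1 (by ext <;> simp <;> omega)
      -- By this, the weights satisfy `s n * s n ≤ s a * s b / M`.
      have hsq : 2 * n ^ 2 + 1 ≤ a ^ 2 + b ^ 2 := by
        obtain ⟨d, rfl⟩ | ⟨d, rfl⟩ : (∃ d, a = b + d) ∨ ∃ d, b = a + d := by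
          rcases le_total a b with h | h
          · exact Or.inr ⟨b - a, by omega⟩
          · exact Or.inl ⟨a - b, by omega⟩
        all_goals
          have : 0 < d := by omega
          nlinarith
      have e1 := prod_comp_update_mul s t i a
      have e2 := prod_comp_update_mul s (Function.update t i a) j b
      rw [Function.update_of_ne hne.symm] at e2
      have e3 : s a * s b * ((∏ l, s (t l)) *
          v (Function.update (Function.update t i a) j b)) =
          (s n * s n) * V (Function.update (Function.update t i a) j b) := by
        rw [hjn] at e2
        rw [← hin] at e1
        simp only [hV]
        linear_combination (-v (Function.update (Function.update t i a) j b)) *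
          (s b * e1 + s n * e2)
      have e4 := congrArg norm e3
      rw [norm_mul, norm_mul, norm_mul (s n * s n), norm_mul (s n), hsn, hsn, hsn, ← pow_add,
        ← pow_add, norm_mul] at e4
      rw [le_div_iff₀ hMpos]
      set y := ‖∏ l, s (t l)‖ * ‖v (Function.update (Function.update t i a) j b)‖
      have hy : 0 ≤ y := by positivity
      have hpow : (M : ℝ) ^ (2 * n ^ 2 + 1) ≤ (M : ℝ) ^ (a ^ 2 + b ^ 2) :=
        pow_le_pow_right₀ (by exact_mod_cast hM1) hsq
      have hnn : (0 : ℝ) < (M : ℝ) ^ (2 * n ^ 2) := by positivity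
      refine le_of_mul_le_mul_left ?_ hnn
      calc (M : ℝ) ^ (2 * n ^ 2) * (y * M) = M ^ (2 * n ^ 2 + 1) * y := by ring
        _ ≤ M ^ (a ^ 2 + b ^ 2) * y := by gcongr
        _ = M ^ (n ^ 2 + n ^ 2) * ‖V (Function.update (Function.update t i a) j b)‖ := e4
        _ ≤ M ^ (2 * n ^ 2) * N := by rw [← two_mul]; gcongr; exact hle _
    have hcardle : (#((antidiagonal (2 * n)).erase (n, n)) : ℝ) ≤ 4 * p + 1 := by
      have := card_erase_le (s := antidiagonal (2 * n)) (a := (n, n))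
      rw [Nat.card_antidiagonal] at this
      have : #((antidiagonal (2 * n)).erase (n, n)) ≤ 4 * p + 1 := by omega
      exact_mod_cast this
    calc ‖V t‖ = ‖∏ l, s (t l)‖ * ‖v t‖ := norm_mul _ _
      _ ≤ ‖∏ l, s (t l)‖ * ∑ x ∈ (antidiagonal (2 * n)).erase (n, n),
        ‖v (Function.update (Function.update t i x.1) j x.2)‖ := by gcongr
      _ ≤ #((antidiagonal (2 * n)).erase (n, n)) • (N / M) := by
        rw [mul_sum]; exact sum_le_card_nsmul _ _ _ h3
      _ ≤ (4 * p + 1) / M * N := by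
        rw [nsmul_eq_mul, div_mul_eq_mul_div, ← mul_div_assoc]; gcongr
  have hVsym : ∀ (σ : Equiv.Perm (Fin (p + 1))) t, V (t ∘ σ) = V t := fun σ t => by
    simp only [hV, hsym, Function.comp_apply]
    rw [Equiv.prod_comp σ (fun l => s (t l))]
  have hNzero : N = 0 := by
    by_cases h : ∃ l, 2 * p < t₀ l
    · rw [hN, hVsupp t₀ h, norm_zero]
    push Not at h
    have h1 := norm_le_of_sum_update_eq_zero V hVsym hV2 (by positivity) hB t₀
      (fun l => Nat.lt_succ_of_le (h l))
    have h2 : 2 * (2 * (p : ℝ) + 1) ^ (p + 1) * ((4 * p + 1) / M * N) = N / 2 := by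
      have : (M : ℝ) = 4 * (2 * p + 1) ^ (p + 1) * (4 * p + 1) := by rw [hM]; push_cast; ring
      rw [this]
      field_simp
      norm_num
    rw [h2, ← hN] at h1
    linarith
  intro t
  have : V t = 0 := norm_le_zero_iff.1 (hNzero ▸ hle t)
  exact (mul_eq_zero.1 this).resolve_left (prod_ne_zero_iff.2 fun l _ => hs0 _)

end SymmetricArrays

/-! ### Alternating and symmetric polynomials -/

section SymmetricPolynomials

open MvPolynomial

variable {σ : Type*}

theorem X_sub_X_dvd_sub_rename [DecidableEq σ] (s t : σ) (f : MvPolynomial σ ℂ) :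
    X s - X t ∣ f - rename (Function.update id s t) f := by
  induction f using MvPolynomial.induction_on with
  | C a => simp
  | add f g hf hg =>
    rw [map_add, add_sub_add_comm]
    exact dvd_add hf hg
  | mul_X f i hf =>
    have h1 : (X s - X t : MvPolynomial σ ℂ) ∣ X i - X (Function.update id s t i) := by
      by_cases h : i = s
      · subst h; simp
      · simp [h]
    rw [map_mul, rename_X]
    have h2 := dvd_add (hf.mul_right (X i)) (h1.mul_left (rename (Function.update id s t) f))
    convert h2 using 1
    ring

/-- A polynomial that changes sign when two variables are exchanged is divisible by their
difference. -/
theorem X_sub_X_dvd_of_rename_swap [DecidableEq σ] {s t : σ} {f : MvPolynomial σ ℂ}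
    (hf : rename (Equiv.swap s t) f = -f) : X s - X t ∣ f := by
  have h1 := X_sub_X_dvd_sub_rename s t f
  have h2 : rename (Function.update id s t) f = - rename (Function.update id s t) f := by
    conv_lhs => rw [← neg_neg f, ← hf, map_neg, rename_rename]
    congr 2
    ext i
    congr 1
    by_cases hs : i = s
    · subst hs; by_cases hst : i = t <;> simp [Function.update_apply]
    by_cases ht : i = t
    · subst ht; simp [Function.update_apply]
    · simp [Equiv.swap_apply_of_ne_of_ne hs ht]
  rwa [self_eq_neg.1 h2, sub_zero] at h1

theorem irreducible_X_sub_X {s t : σ} (h : s ≠ t) :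
    Irreducible (X s - X t : MvPolynomial σ ℂ) := by
  classical
  have hc : coeff (Finsupp.single s 1) (X s - X t : MvPolynomial σ ℂ) = 1 := by
    simp [coeff_X, Finsupp.single_left_inj, h.symm]
  refine irreducible_of_totalDegree_eq_one (le_antisymm ?_ ?_) fun x hx => ?_
  · exact (totalDegree_sub _ _).trans (by simp)
  · have := le_totalDegree (p := (X s - X t : MvPolynomial σ ℂ)) (s := Finsupp.single s 1)
      (by rw [mem_support_iff, hc]; exact one_ne_zero)
    simpa using this
  · exact isUnit_of_dvd_one (hc ▸ hx (Finsupp.single s 1))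

/-- Alternating polynomials are divisible by the Vandermonde determinant. -/
theorem det_vandermonde_X_dvd {n : ℕ} {f : MvPolynomial (Fin n) ℂ}
    (hf : ∀ s t, s ≠ t → rename (Equiv.swap s t) f = -f) :
    (Matrix.vandermonde (X : Fin n → MvPolynomial (Fin n) ℂ)).det ∣ f := by
  rw [Matrix.det_vandermonde, Finset.prod_sigma']
  refine Finset.prod_dvd_of_isRelPrime ?_ ?_
  · rintro ⟨i, j⟩ hij ⟨i', j'⟩ hij' hne
    simp only [Finset.coe_sigma, Set.mem_sigma_iff, Finset.coe_univ, Set.mem_univ, true_and,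
      Finset.coe_Ioi, Set.mem_Ioi] at hij hij'
    refine (irreducible_X_sub_X hij.ne').isRelPrime_iff_not_dvd.2 fun hd => ?_
    have h1 := map_dvd (rename (R := ℂ) (Function.update id i j)) hd
    simp only [map_sub, rename_X, Function.update_self, Function.update_of_ne hij.ne', id,
      sub_self, zero_dvd_iff, sub_eq_zero] at h1
    have h2 := X_injective h1
    simp only [Function.update_apply, id] at h2
    split_ifs at h2 <;> grind
  · rintro ⟨i, j⟩ hij
    simp only [Finset.mem_sigma, Finset.mem_Ioi, Finset.mem_univ, true_and] at hij
    exact X_sub_X_dvd_of_rename_swap (hf _ _ hij.ne')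

theorem rename_det_vandermonde_comp {n : ℕ} (e : Equiv.Perm (Fin n))
    (v : Fin n → MvPolynomial (Fin n) ℂ) (hv : ∀ i, rename e (v i) = v (e i)) :
    rename e (Matrix.vandermonde v).det =
      ((Equiv.Perm.sign e : ℤ) : MvPolynomial (Fin n) ℂ) * (Matrix.vandermonde v).det := by
  rw [← Matrix.det_permute, AlgHom.map_det]
  congr 1
  ext1 i j
  simp [Matrix.vandermonde_apply, hv]

theorem det_vandermonde_X_ne_zero (n : ℕ) :
    (Matrix.vandermonde (X : Fin n → MvPolynomial (Fin n) ℂ)).det ≠ 0 :=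
  Matrix.det_vandermonde_ne_zero_iff.2 X_injective

theorem isSymmetric_of_adjacent_swap {n : ℕ} {f : MvPolynomial (Fin (n + 1)) ℂ}
    (hf : ∀ i : Fin n, rename (Equiv.swap i.castSucc i.succ) f = f) : f.IsSymmetric := by
  intro e
  have he : e ∈ Submonoid.closure (Set.range fun i : Fin n => Equiv.swap i.castSucc i.succ) := by
    rw [Equiv.Perm.mclosure_swap_castSucc_succ]; trivial
  induction he using Submonoid.closure_induction with
  | mem e he => obtain ⟨i, rfl⟩ := he; exact hf i
  | one => simp
  | mul e e' _ _ h h' =>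
    rw [Equiv.Perm.coe_mul, ← rename_rename, h', h]

/-- The product of the pairwise sums of the variables. -/
noncomputable def pairSums (n : ℕ) : MvPolynomial (Fin n) ℂ :=
  ∏ i, ∏ j ∈ Finset.Ioi i, (X j + X i)

theorem det_vandermonde_sq (n : ℕ) :
    (Matrix.vandermonde fun i : Fin n => (X i ^ 2 : MvPolynomial (Fin n) ℂ)).det =
      pairSums n * (Matrix.vandermonde (X : Fin n → MvPolynomial (Fin n) ℂ)).det := by
  rw [Matrix.det_vandermonde, Matrix.det_vandermonde, pairSums, ← Finset.prod_mul_distrib]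
  refine Finset.prod_congr rfl fun i _ => ?_
  rw [← Finset.prod_mul_distrib]
  exact Finset.prod_congr rfl fun j _ => by ring

theorem rename_pairSums {n : ℕ} (e : Equiv.Perm (Fin n)) :
    rename e (pairSums n) = pairSums n := by
  have h1 := congrArg (rename e) (det_vandermonde_sq n)
  rw [map_mul, rename_det_vandermonde_comp e _ (fun i => by rw [map_pow, rename_X]),
    rename_det_vandermonde_comp e X (fun i => rename_X _ _), det_vandermonde_sq] at h1
  have h0 := det_vandermonde_X_ne_zero n
  generalize (Matrix.vandermonde (X : Fin n → MvPolynomial (Fin n) ℂ)).det = v at h0 h1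
  rcases Int.units_eq_one_or (Equiv.Perm.sign e) with h | h
  · rw [h, Units.val_one, Int.cast_one, one_mul, one_mul] at h1
    exact (mul_right_cancel₀ h0 h1).symm
  · rw [h, Units.val_neg, Units.val_one, Int.cast_neg, Int.cast_one, neg_one_mul, neg_one_mul,
      mul_neg, neg_inj] at h1
    exact (mul_right_cancel₀ h0 h1).symm

theorem pairSums_ne_zero (n : ℕ) : pairSums n ≠ 0 := by
  refine Finset.prod_ne_zero_iff.2 fun i _ => Finset.prod_ne_zero_iff.2 fun j _ h => ?_
  have := congrArg (eval fun _ => (1 : ℂ)) h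
  norm_num at this

theorem X_add_X_dvd_pairSums {n : ℕ} {i j : Fin n} (h : i ≠ j) : X i + X j ∣ pairSums n := by
  wlog hij : i < j generalizing i j
  · rw [add_comm]; exact this h.symm (lt_of_le_of_ne (not_lt.1 hij) h.symm)
  rw [add_comm]
  exact (Finset.dvd_prod_of_mem (fun j => X j + X i) (Finset.mem_Ioi.2 hij)).trans
    (Finset.dvd_prod_of_mem (fun i => ∏ j ∈ Finset.Ioi i, (X j + X i)) (Finset.mem_univ i))

theorem finSuccEquiv_pairSums (n : ℕ) : finSuccEquiv ℂ n (pairSums (n + 1)) =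
    (∏ t, (Polynomial.X + Polynomial.C (X t))) * Polynomial.C (pairSums n) := by
  rw [pairSums, Fin.prod_univ_succ, map_mul, Fin.prod_Ioi_zero]
  simp only [Fin.prod_Ioi_succ, map_prod, map_add, finSuccEquiv_X_succ, finSuccEquiv_X_zero,
    pairSums]
  congr 1
  exact Finset.prod_congr rfl fun i _ => add_comm _ _

/-- The coefficients of a multiple of `X i + X j` have alternating sum zero along antidiagonals in
the exponents of `X i` and `X j`. -/
theorem sum_antidiagonal_coeff_update_eq_zero {n : ℕ} {f : MvPolynomial (Fin n) ℂ} {i j : Fin n}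
    (hij : i ≠ j) (hf : X i + X j ∣ f) (t : Fin n → ℕ) (c : ℕ) :
    ∑ x ∈ Finset.HasAntidiagonal.antidiagonal c, (-1) ^ x.1 * coeff (Finsupp.equivFunOnFinite.symm
      (Function.update (Function.update t i x.1) j x.2)) f = 0 := by
  obtain ⟨g, rfl⟩ := hf
  set d : ℕ → ℕ → Fin n →₀ ℕ := fun a b => Finsupp.equivFunOnFinite.symm
    (Function.update (Function.update t i a) j b)
  have hi0 : ∀ b, coeff (d 0 b) (X i * g) = 0 := fun b => by
    rw [coeff_X_mul', if_neg]; simp [d, hij]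
  have hj0 : ∀ a, coeff (d a 0) (X j * g) = 0 := fun a => by
    rw [coeff_X_mul', if_neg]; simp [d]
  have hi : ∀ a b, coeff (d (a + 1) b) (X i * g) = coeff (d a b) g := fun a b => by
    rw [← coeff_X_mul (d a b) i g]
    congr 1
    ext l
    by_cases h1 : l = i
    · subst h1; simp [d, hij, add_comm]
    by_cases h2 : l = j
    · subst h2; simp [d, h1]
    · simp [d, h1, h2]
  have hj : ∀ a b, coeff (d a (b + 1)) (X j * g) = coeff (d a b) g := fun a b => by
    rw [← coeff_X_mul (d a b) j g]
    congr 1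
    ext l
    by_cases h1 : l = j
    · subst h1; simp [d, add_comm]
    by_cases h2 : l = i
    · subst h2; simp [d, h1]
    · simp [d, h1, h2]
  change ∑ x ∈ Finset.HasAntidiagonal.antidiagonal c, (-1) ^ x.1 * coeff (d x.1 x.2) _ = 0
  simp only [add_mul, coeff_add, mul_add, Finset.sum_add_distrib]
  cases c with
  | zero => simp [hi0, hj0]
  | succ c =>
    rw [Finset.Nat.sum_antidiagonal_succ, Finset.Nat.sum_antidiagonal_succ']
    simp only [hi0, hj0, hi, hj, mul_zero, zero_add, ← Finset.sum_add_distrib]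
    exact Finset.sum_eq_zero fun x _ => by ring

end SymmetricPolynomials

/-! ### Polynomials with an exchange relation -/

section ExchangeRelation

open MvPolynomial

theorem coeff_nodal_X_mul_neg_one_pow {p : ℕ} (k : ℕ) :
    (nodal (X : Fin p → MvPolynomial (Fin p) ℂ)).coeff k * (-1) ^ k =
      (-1) ^ p * (∏ t : Fin p, (Polynomial.X + Polynomial.C (X t)) :
        Polynomial (MvPolynomial (Fin p) ℂ)).coeff k := by
  have h1 : (nodal (X : Fin p → MvPolynomial (Fin p) ℂ)).comp
      (Polynomial.C (-1) * Polynomial.X) =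
      Polynomial.C ((-1) ^ p) * ∏ t : Fin p, (Polynomial.X + Polynomial.C (X t)) := by
    have h2 : (Polynomial.C ((-1) ^ p) : Polynomial (MvPolynomial (Fin p) ℂ)) =
        ∏ _t : Fin p, (-1) := by simp
    rw [nodal, Polynomial.prod_comp, h2, ← Finset.prod_mul_distrib]
    exact Finset.prod_congr rfl fun t _ => by simp; ring
  rw [← Polynomial.comp_C_mul_X_coeff, h1, Polynomial.coeff_C_mul]

theorem sum_mul_coeff_mul {A : Type*} [CommRing A] {p : ℕ} (s : ℕ → A) (f : Fin (p + 1) → A)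
    {g : Polynomial A} (hg : g.natDegree < p + 1) :
    ∑ a ∈ Finset.range (2 * p + 1), s a *
      ((∑ j : Fin (p + 1), Polynomial.C (f j) * Polynomial.X ^ (j : ℕ)) * g).coeff a =
    ∑ j : Fin (p + 1), (∑ k : Fin (p + 1), g.coeff k * s (j + k)) * f j := by
  simp only [Finset.sum_mul, Polynomial.finsetSum_coeff, mul_assoc, Polynomial.coeff_C_mul,
    ← sum_coeff_mul_ite hg, Finset.mul_sum]
  rw [Finset.sum_comm]
  refine Finset.sum_congr rfl fun j _ => ?_
  rw [Finset.sum_comm]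
  refine Finset.sum_congr rfl fun k _ => ?_
  rw [Finset.sum_eq_single ((j : ℕ) + k)]
  · rw [if_pos rfl]; ring
  · intro a _ ha
    rw [if_neg ha]; ring
  · intro h
    exact absurd (Finset.mem_range.2 (by omega)) h

/-- A polynomial in `X 0` whose coefficients are polynomials in the other variables, given by its
list of coefficients. -/
noncomputable def ofCoeffs {n N : ℕ} (w : Fin N → MvPolynomial (Fin n) ℂ) :
    MvPolynomial (Fin (n + 1)) ℂ :=
  ∑ j, rename Fin.succ (w j) * X 0 ^ (j : ℕ)

theorem finSuccEquiv_ofCoeffs {n N : ℕ} (w : Fin N → MvPolynomial (Fin n) ℂ) :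
    finSuccEquiv ℂ n (ofCoeffs w) = ∑ j, Polynomial.C (w j) * Polynomial.X ^ (j : ℕ) := by
  have h : ∀ f : MvPolynomial (Fin n) ℂ,
      finSuccEquiv ℂ n (rename Fin.succ f) = Polynomial.C f := fun f => by
    induction f using MvPolynomial.induction_on with
    | C a => simp [finSuccEquiv_apply]
    | add f g hf hg => rw [map_add, map_add, hf, hg, map_add]
    | mul_X f i hf => rw [map_mul, map_mul, hf, rename_X, finSuccEquiv_X_succ, map_mul]
  simp [ofCoeffs, finSuccEquiv_X_zero, h]

theorem ofCoeffs_eq_zero {n N : ℕ} {w : Fin N → MvPolynomial (Fin n) ℂ} (h : ofCoeffs w = 0) :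
    w = 0 := by
  have h1 := finSuccEquiv_ofCoeffs w
  rw [h, map_zero] at h1
  ext1 j
  have := congrArg (fun f => Polynomial.coeff f j) h1
  simp only [Polynomial.finsetSum_coeff, Polynomial.coeff_C_mul_X_pow, Polynomial.coeff_zero]
    at this
  rw [Finset.sum_eq_single j] at this
  · simpa using this.symm
  · intro j' _ hj'
    rw [if_neg (fun h => hj' (Fin.ext h.symm))]
  · simp

theorem ofCoeffs_const_mul {n N : ℕ} (c : MvPolynomial (Fin n) ℂ)
    (w : Fin N → MvPolynomial (Fin n) ℂ) :
    ofCoeffs (fun j => c * w j) = rename Fin.succ c * ofCoeffs w := by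
  simp [ofCoeffs, Finset.mul_sum, mul_assoc]

/-- An alternating polynomial is the Vandermonde determinant times a symmetric one. -/
theorem exists_eq_det_vandermonde_mul {n : ℕ} {f : MvPolynomial (Fin n) ℂ}
    (hf : ∀ s t, s ≠ t → rename (Equiv.swap s t) f = -f) :
    ∃ g : MvPolynomial (Fin n) ℂ,
      f = (Matrix.vandermonde (X : Fin n → MvPolynomial (Fin n) ℂ)).det * g ∧
        ∀ s t, s ≠ t → rename (Equiv.swap s t) g = g := by
  obtain ⟨g, hg⟩ := det_vandermonde_X_dvd hf
  refine ⟨g, hg, fun s t hst => ?_⟩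
  have h1 := hf s t hst
  rw [hg, map_mul, rename_det_vandermonde_comp _ X (fun i => rename_X _ _),
    Equiv.Perm.sign_swap hst, ← mul_neg] at h1
  simp only [Units.val_neg, Units.val_one, Int.cast_neg, Int.cast_one, neg_mul, one_mul,
    mul_neg, neg_inj] at h1
  exact mul_left_cancel₀ (det_vandermonde_X_ne_zero n) h1

theorem rename_succ_det_vandermonde (k : ℕ) :
    rename Fin.succ (Matrix.vandermonde (X : Fin (k + 1) → MvPolynomial (Fin (k + 1)) ℂ)).det =
      (∏ t : Fin k, (X t.succ.succ - X 1)) * ∏ i : Fin k, ∏ j ∈ Finset.Ioi i,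
        (X j.succ.succ - X i.succ.succ : MvPolynomial (Fin (k + 2)) ℂ) := by
  rw [Matrix.det_vandermonde, Fin.prod_univ_succ, map_mul, Fin.prod_Ioi_zero]
  simp [Fin.prod_Ioi_succ]

theorem ofCoeffs_isSymmetric {k N : ℕ} {l : Fin N → MvPolynomial (Fin (k + 1)) ℂ}
    (hl : ∀ j s t, s ≠ t → rename (Equiv.swap s t) (l j) = l j)
    (hl01 : rename (Equiv.swap 0 1) (ofCoeffs l) = ofCoeffs l) :
    (ofCoeffs l).IsSymmetric := by
  refine isSymmetric_of_adjacent_swap fun i => ?_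
  induction i using Fin.cases with
  | zero => exact hl01
  | succ i =>
    simp only [ofCoeffs, map_sum, map_mul, map_pow, rename_X, rename_rename]
    refine Finset.sum_congr rfl fun j _ => ?_
    congr 1
    conv_rhs => rw [← hl j i.castSucc i.succ Fin.castSucc_lt_succ.ne, rename_rename]
    congr 2
    ext1 x
    simp only [Function.comp_apply]
    rw [← Fin.succ_castSucc, (Fin.succ_injective _).swap_apply]

/-- The Vandermonde determinant in the variables other than `X 0` satisfies the exchange relation;
hence its other factor is invariant under the exchange of `X 0` and `X 1`. -/
theorem rename_swap_eq_of_exchange {k : ℕ} {f : MvPolynomial (Fin (k + 2)) ℂ}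
    (h : rename Fin.succ (Matrix.vandermonde (X : Fin (k + 1) → MvPolynomial (Fin (k + 1)) ℂ)).det *
        f * ∏ t : Fin k, (X 0 - X t.succ.succ) =
      rename (Equiv.swap 0 1) (rename Fin.succ
        (Matrix.vandermonde (X : Fin (k + 1) → MvPolynomial (Fin (k + 1)) ℂ)).det * f) *
        ∏ t : Fin k, (X 1 - X t.succ.succ)) : rename (Equiv.swap 0 1) f = f := by
  rw [rename_succ_det_vandermonde] at h
  have hD0 : (∏ i : Fin k, ∏ j ∈ Finset.Ioi i,
      (X j.succ.succ - X i.succ.succ : MvPolynomial (Fin (k + 2)) ℂ)) ≠ 0 := by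
    refine Finset.prod_ne_zero_iff.2 fun i _ => Finset.prod_ne_zero_iff.2 fun j hj => ?_
    rw [sub_ne_zero, Ne, X_inj, Fin.succ_inj, Fin.succ_inj]
    exact (Finset.mem_Ioi.1 hj).ne'
  have hA0 : ∀ i : Fin (k + 2), i = 0 ∨ i = 1 →
      (∏ t : Fin k, (X i - X t.succ.succ : MvPolynomial (Fin (k + 2)) ℂ)) ≠ 0 := fun i hi => by
    refine Finset.prod_ne_zero_iff.2 fun t _ => ?_
    rw [sub_ne_zero, Ne, X_inj]
    rcases hi with rfl | rfl <;> simp [Fin.ext_iff]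
  have hneg : ∀ i : Fin (k + 2), (∏ t : Fin k, (X t.succ.succ - X i)) =
      (-1) ^ k * ∏ t : Fin k, (X i - X t.succ.succ : MvPolynomial (Fin (k + 2)) ℂ) :=
      fun i => by
    rw [← Fin.prod_const, ← Finset.prod_mul_distrib]
    exact Finset.prod_congr rfl fun t _ => by ring
  have hswap : ∀ t : Fin k, Equiv.swap (0 : Fin (k + 2)) 1 t.succ.succ = t.succ.succ :=
    fun t => Equiv.swap_apply_of_ne_of_ne (by simp [Fin.ext_iff]) (by simp [Fin.ext_iff])
  simp only [map_mul, map_prod, map_sub, rename_X, hswap, Equiv.swap_apply_right] at h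
  rw [hneg, hneg] at h
  have h1 : ((-1) ^ k : MvPolynomial (Fin (k + 2)) ℂ) ≠ 0 := pow_ne_zero _ (by simp)
  have hA := hA0 0 (Or.inl rfl)
  have hB := hA0 1 (Or.inr rfl)
  generalize (∏ i : Fin k, ∏ j ∈ Finset.Ioi i,
      (X j.succ.succ - X i.succ.succ : MvPolynomial (Fin (k + 2)) ℂ)) = D at hD0 h
  generalize (∏ t : Fin k, (X 0 - X t.succ.succ : MvPolynomial (Fin (k + 2)) ℂ)) = A at hA h
  generalize (∏ t : Fin k, (X 1 - X t.succ.succ : MvPolynomial (Fin (k + 2)) ℂ)) = B at hB h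
  refine mul_left_cancel₀ (mul_ne_zero h1 (mul_ne_zero hD0 (mul_ne_zero hA hB))) ?_
  linear_combination -h

theorem coeff_finSuccEquiv_ofCoeffs_mul_pairSums {p i : ℕ}
    (l : Fin (p + 1) → MvPolynomial (Fin p) ℂ) (hi : 2 * p < i) :
    (finSuccEquiv ℂ p (ofCoeffs l * pairSums (p + 1))).coeff i = 0 := by
  rw [map_mul, finSuccEquiv_ofCoeffs, finSuccEquiv_pairSums, ← mul_assoc, Polynomial.coeff_mul_C,
    Polynomial.coeff_eq_zero_of_natDegree_lt, zero_mul]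
  refine Polynomial.natDegree_mul_le.trans_lt (lt_of_le_of_lt ?_ hi)
  rw [two_mul]
  refine add_le_add (Polynomial.natDegree_sum_le_of_forall_le _ _ fun j _ =>
    (Polynomial.natDegree_C_mul_X_pow_le _ _).trans (by omega)) ?_
  refine (Polynomial.natDegree_prod_le _ _).trans ?_
  simp

theorem sum_mul_coeff_finSuccEquiv_ofCoeffs_mul_pairSums {p : ℕ} (s : ℕ → ℂ)
    (l : Fin (p + 1) → MvPolynomial (Fin p) ℂ)
    (h : ∑ j : Fin (p + 1), (∑ i : Fin (p + 1), (nodal X).coeff i *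
      ((-1) ^ (i : ℕ) * C (s (j + i)))) * l j = 0) :
    ∑ a ∈ Finset.range (2 * p + 1), C (s a) *
      (finSuccEquiv ℂ p (ofCoeffs l * pairSums (p + 1))).coeff a = 0 := by
  have h2 : ∀ j : Fin (p + 1), (∑ i : Fin (p + 1), (nodal X).coeff i *
      ((-1) ^ (i : ℕ) * C (s (j + i)))) = (-1) ^ p * ∑ i : Fin (p + 1),
        (∏ t : Fin p, (Polynomial.X + Polynomial.C (X t)) :
          Polynomial (MvPolynomial (Fin p) ℂ)).coeff i * C (s (j + i)) := fun j => by
    rw [Finset.mul_sum]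
    refine Finset.sum_congr rfl fun i _ => ?_
    rw [← mul_assoc, coeff_nodal_X_mul_neg_one_pow, mul_assoc]
  simp only [h2, mul_assoc] at h
  rw [← Finset.mul_sum] at h
  have h3 := (mul_eq_zero.1 h).resolve_left (pow_ne_zero _ (by simp))
  rw [map_mul, finSuccEquiv_ofCoeffs, finSuccEquiv_pairSums, ← mul_assoc]
  simp only [Polynomial.coeff_mul_C, ← mul_assoc]
  rw [← Finset.sum_mul, sum_mul_coeff_mul (fun a => C (s a)) l (by
    refine Nat.lt_succ_of_le ((Polynomial.natDegree_prod_le _ _).trans ?_)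
    simp), h3, zero_mul]

/-- For suitable weights, a symmetric polynomial that is divisible by all `X i + X j` and has
degree at most `2 * p` in each variable vanishes if the weighted sum of its coefficients with
respect to one variable vanishes. -/
theorem exists_weights_isSymmetric (p : ℕ) : ∃ s : ℕ → ℂ, ∀ f : MvPolynomial (Fin (p + 1)) ℂ,
    f.IsSymmetric → (∀ i j, i ≠ j → X i + X j ∣ f) →
    (∀ i, 2 * p < i → (finSuccEquiv ℂ p f).coeff i = 0) →
    ∑ a ∈ Finset.range (2 * p + 1), C (s a) * (finSuccEquiv ℂ p f).coeff a = 0 → f = 0 := by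
  obtain ⟨s, hs⟩ := exists_weights p
  refine ⟨s, fun f hsymm hdvd hdeg hsum => ?_⟩
  have hcons : ∀ t : Fin (p + 1) → ℕ, coeff (Finsupp.equivFunOnFinite.symm t) f =
      coeff (Finsupp.equivFunOnFinite.symm (Fin.tail t)) ((finSuccEquiv ℂ p f).coeff (t 0)) :=
      fun t => by
    rw [finSuccEquiv_coeff_coeff]
    congr 1
    ext i
    induction i using Fin.cases <;> simp [Fin.tail]
  have hvsymm : ∀ (e : Equiv.Perm (Fin (p + 1))) (t : Fin (p + 1) → ℕ),
      coeff (Finsupp.equivFunOnFinite.symm (t ∘ e)) f =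
        coeff (Finsupp.equivFunOnFinite.symm t) f := fun e t => by
    rw [← coeff_rename_mapDomain e e.injective, hsymm]
    congr 1
    ext i
    rw [Finsupp.mapDomain_equiv_apply]
    simp
  have hv := hs (fun t => coeff (Finsupp.equivFunOnFinite.symm t) f) hvsymm ?_ ?_
    (fun t i j n hij _ _ => sum_antidiagonal_coeff_update_eq_zero hij (hdvd i j hij) t _)
  · ext d
    rw [coeff_zero, ← hv (Finsupp.equivFunOnFinite d), Equiv.symm_apply_apply]
  · rintro t ⟨i, hi⟩
    rw [← hvsymm (Equiv.swap 0 i), hcons, hdeg, coeff_zero]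
    simpa using hi
  · intro t i
    have h1 : ∀ a, Function.update t i a ∘ Equiv.swap 0 i =
        Function.update (t ∘ Equiv.swap 0 i) 0 a := fun a => by
      rw [Function.update_comp_equiv]; simp
    have h2 := congrArg (coeff (Finsupp.equivFunOnFinite.symm
      (Fin.tail (t ∘ Equiv.swap 0 i)))) hsum
    rw [coeff_sum, coeff_zero] at h2
    rw [← h2]
    refine Finset.sum_congr rfl fun a _ => ?_
    rw [← hvsymm (Equiv.swap 0 i), h1, hcons, coeff_C_mul, Fin.tail_update_zero,
      Function.update_self]

/-- For suitable weights, an alternating family of coefficients vanishes under an exchange relation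
for the polynomial with these coefficients and one weighted linear relation. The exchange relation
makes the quotient by the Vandermonde determinant a symmetric polynomial in all variables; its
product with `pairSums` has the properties required by `exists_weights_isSymmetric`. -/
theorem exists_weights_ofCoeffs (k : ℕ) : ∃ s : ℕ → ℂ,
    ∀ w : Fin (k + 2) → MvPolynomial (Fin (k + 1)) ℂ,
    (∀ j s t, s ≠ t → rename (Equiv.swap s t) (w j) = -w j) →
    (ofCoeffs w * ∏ t : Fin k, (X 0 - X t.succ.succ) =
      rename (Equiv.swap 0 1) (ofCoeffs w) * ∏ t : Fin k, (X 1 - X t.succ.succ)) →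
    (∑ j : Fin (k + 2), (∑ l : Fin (k + 2), (nodal X).coeff l *
      ((-1) ^ (l : ℕ) * C (s (j + l)))) * w j = 0) → w = 0 := by
  obtain ⟨s, hs⟩ := exists_weights_isSymmetric (k + 1)
  refine ⟨s, fun w halt hrel hθ => ?_⟩
  choose l hwl hl using fun j => exists_eq_det_vandermonde_mul (halt j)
  obtain rfl : w = _ := funext hwl
  suffices h : ofCoeffs l = 0 by
    rw [ofCoeffs_eq_zero h]; ext1 j; simp
  rw [ofCoeffs_const_mul] at hrel
  have hsymm := ofCoeffs_isSymmetric hl (rename_swap_eq_of_exchange hrel)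
  refine (mul_eq_zero.1 (hs (ofCoeffs l * pairSums (k + 2)) ?_ ?_ ?_ ?_)).resolve_right
    (pairSums_ne_zero (k + 2))
  · intro e
    rw [map_mul, hsymm, rename_pairSums]
  · exact fun i j hij => (X_add_X_dvd_pairSums hij).mul_left _
  · exact fun i hi => coeff_finSuccEquiv_ofCoeffs_mul_pairSums l hi
  · refine sum_mul_coeff_finSuccEquiv_ofCoeffs_mul_pairSums s l ?_
    refine (mul_eq_zero.1 ?_).resolve_left (det_vandermonde_X_ne_zero (k + 1))
    rw [← hθ, Finset.mul_sum]
    exact Finset.sum_congr rfl fun j _ => mul_left_comm _ _ _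

end ExchangeRelation

/-! ### The twisted Hankel tensor -/

section TwistedHankel

variable {a : ℕ}

/-- Evaluation at the point `x` of polynomials of degree less than `d`, as a covector on a space
whose first `d` basis vectors are the monomials; it annihilates the other basis vectors. -/
def evalCovector {A : Type*} [CommRing A] (a d : ℕ) (x : A) : Fin a → A :=
  fun i => if (i : ℕ) < d then x ^ (i : ℕ) else 0

theorem evalCovector_of_lt {A : Type*} [CommRing A] {d : ℕ} (x : A) {i : Fin a}
    (h : (i : ℕ) < d) : evalCovector a d x i = x ^ (i : ℕ) := if_pos h

theorem evalCovector_of_le {A : Type*} [CommRing A] {d : ℕ} (x : A) {i : Fin a}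
    (h : d ≤ (i : ℕ)) : evalCovector a d x i = 0 := if_neg h.not_gt

theorem comp_evalCovector {A B : Type*} [CommRing A] [CommRing B] (h : A →+* B) (d : ℕ) (x : A) :
    h ∘ evalCovector a d x = evalCovector a d (h x) := by
  ext i
  by_cases hi : (i : ℕ) < d <;> simp [evalCovector, hi]

theorem evalCovector_dotProduct_coeff {A : Type*} [CommRing A] {d : ℕ} (hda : d ≤ a) (x : A)
    {f : Polynomial A} (hf : f.natDegree < d) :
    (evalCovector a d x ⬝ᵥ fun i => f.coeff i) = f.eval x :=
  dotProduct_coeff hda (fun _ hi => evalCovector_of_lt x hi) hf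

theorem eq_zero_of_forall_evalCovector_dotProduct {d : ℕ} (h : Fin a → ℂ)
    (hh : ∀ x, evalCovector a d x ⬝ᵥ h = 0) (i : Fin a) (hi : (i : ℕ) < d) : h i = 0 := by
  have := eq_zero_of_forall_dotProduct_geom (d := d) (fun i => if (i : ℕ) < d then h i else 0)
    (fun ξ ⟨x, hx⟩ => by
      refine Eq.trans ?_ (hh x)
      refine Finset.sum_congr rfl fun i _ => ?_
      by_cases hi : (i : ℕ) < d
      · simp only [if_pos hi, hx i hi, evalCovector_of_lt x hi]
      · simp only [if_neg hi]
        rw [evalCovector_of_le x (not_lt.1 hi), mul_zero, zero_mul]) i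
  simpa [hi] using this

/-- The value of a form at the evaluations at `k` points, over an extension of scalars. -/
noncomputable def formValue {A : Type*} [CommRing A] [Algebra ℂ A] (d : ℕ) {k : ℕ} (x : Fin k → A)
    (f : Finset (Fin a) → ℂ) : A :=
  contractMulti A a k (fun t => evalCovector a d (x t)) (algebraMap ℂ A ∘ f) ∅

theorem map_formValue {A B : Type*} [CommRing A] [Algebra ℂ A] [CommRing B] [Algebra ℂ B]
    (h : A →ₐ[ℂ] B) (d : ℕ) {k : ℕ} (x : Fin k → A) (f : Finset (Fin a) → ℂ) :
    h (formValue d x f) = formValue d (h ∘ x) f := by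
  have := contractMulti_map (h : A →+* B) (fun t => evalCovector a d (x t))
    (algebraMap ℂ A ∘ f) ∅
  simp only [comp_evalCovector] at this
  refine this.trans ?_
  rw [formValue, ← Function.comp_assoc]
  have hc : (h : A →+* B) ∘ algebraMap ℂ A = algebraMap ℂ B := funext fun z => h.commutes z
  rw [hc]
  rfl

theorem formValue_comp_swap {A : Type*} [CommRing A] [Algebra ℂ A] (d : ℕ) {k : ℕ} (x : Fin k → A)
    (f : Finset (Fin a) → ℂ) {s t : Fin k} (hst : s ≠ t) :
    formValue d (x ∘ Equiv.swap s t) f = -formValue d x f := by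
  have := (contractMulti A a k).map_swap (fun t => evalCovector a d (x t)) hst
  exact congrFun (congrArg (fun φ : Module.End A (Finset (Fin a) → A) =>
    φ (algebraMap ℂ A ∘ f)) this) ∅

/-- An exchange identity from the contraction of `∑ j, f j ∧ u j = 0` with two covectors. -/
theorem sum_dotProduct_mul_contract {A β : Type*} [CommRing A] [Fintype β] {u : β → Fin a → A}
    {f : β → Finset (Fin a) → A} (h : ∑ j, wedge A a (u j) (f j) = 0) (ξ ζ : Fin a → A) :
    ∑ j, (ζ ⬝ᵥ u j) * contract A a ξ (f j) ∅ = ∑ j, (ξ ⬝ᵥ u j) * contract A a ζ (f j) ∅ := by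
  have h1 := congrFun (congrArg (contract A a ξ) (congrArg (contract A a ζ) h)) ∅
  simp only [map_sum, map_zero, Finset.sum_apply, Pi.zero_apply] at h1
  rw [← sub_eq_zero, ← Finset.sum_sub_distrib, ← h1]
  refine Finset.sum_congr rfl fun j _ => ?_
  have h2 := congrFun (congrArg (contract A a ξ) (contract_wedge ζ (u j) (f j))) ∅
  have h3 := congrFun (contract_wedge ξ (u j) (contract A a ζ (f j))) ∅
  simp only [map_add, map_smul, Pi.add_apply, Pi.smul_apply, smul_eq_mul,
    wedge_apply_empty, add_zero] at h2 h3
  rw [← h2, ← h3]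
  ring

/-- The tensor of the map `(f₁, f₂), (g₁, g₂) ↦ f₁ g₁ + f₂ g₂ + θ (f₂, g₁) z` where `f₁` and `g₂`
are polynomials of degree less than `p`, `f₂` and `g₁` are polynomials of degree at most `p`, `z` is
an additional basis vector, and `θ (f, g)` is the value at `f(X) g(-X)` of the linear form with
values `s` at the monomials. -/
def twistedHankelTensor (s : ℕ → ℂ) (p : ℕ) (i : Fin (2 * p + 1)) :
    Fin p ⊕ Fin (p + 1) → Fin (p + 1) ⊕ Fin p → ℂ
  | .inl j, .inl k => if (i : ℕ) = j + k then 1 else 0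
  | .inl _, .inr _ => 0
  | .inr j, .inr k => if (i : ℕ) = j + k then 1 else 0
  | .inr j, .inl k => if (i : ℕ) = 2 * p then (-1) ^ (k : ℕ) * s (j + k) else 0

section Relations

open Polynomial

variable {s : ℕ → ℂ} {p : ℕ} {W : Fin p ⊕ Fin (p + 1) → Finset (Fin (2 * p + 1)) → ℂ}
  {A : Type*} [CommRing A] [Algebra ℂ A]

/-- The relations between the components of an element of the kernel obtained by pairing with a
polynomial `g₁`. -/
theorem sum_wedge_twistedHankelTensor_inl
    (hW : ∀ k, ∑ j, wedge ℂ _ (fun i => twistedHankelTensor s p i j k) (W j) = 0) {q : A[X]}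
    (hq : q.natDegree < p + 1) :
    ∑ j : Fin p, wedge A _ (fun i => (X ^ (j : ℕ) * q).coeff i) (algebraMap ℂ A ∘ W (.inl j)) +
    ∑ j : Fin (p + 1), wedge A _ (fun i => if (i : ℕ) = 2 * p then ∑ k : Fin (p + 1), q.coeff k *
      ((-1) ^ (k : ℕ) * algebraMap ℂ A (s (j + k))) else 0) (algebraMap ℂ A ∘ W (.inr j)) = 0 := by
  rw [← sum_wedge_sum_mul_eq_zero hW (Sum.elim (fun k => q.coeff k) 0), Fintype.sum_sum_type]
  congr 1
  · refine Finset.sum_congr rfl fun j _ => ?_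
    congr 2
    ext i
    rw [← sum_coeff_mul_ite hq, Fintype.sum_sum_type]
    simp [twistedHankelTensor]
  · refine Finset.sum_congr rfl fun j _ => ?_
    congr 2
    ext i
    rw [Fintype.sum_sum_type]
    by_cases hi : (i : ℕ) = 2 * p <;> simp [twistedHankelTensor, hi]

/-- The relations between the components of an element of the kernel obtained by pairing with a
polynomial `g₂`. -/
theorem sum_wedge_twistedHankelTensor_inr
    (hW : ∀ k, ∑ j, wedge ℂ _ (fun i => twistedHankelTensor s p i j k) (W j) = 0) {q : A[X]}
    (hq : q.natDegree < p) :
    ∑ j : Fin (p + 1), wedge A _ (fun i => (X ^ (j : ℕ) * q).coeff i)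
      (algebraMap ℂ A ∘ W (.inr j)) = 0 := by
  rw [← sum_wedge_sum_mul_eq_zero hW (Sum.elim 0 (fun k : Fin p => q.coeff k)),
    Fintype.sum_sum_type]
  have h1 : ∀ j : Fin p, (fun i => ∑ k,
      Sum.elim (0 : Fin (p + 1) → A) (fun k : Fin p => q.coeff k) k *
      algebraMap ℂ A (twistedHankelTensor s p i (.inl j) k)) = 0 := fun j => by
    ext i
    rw [Fintype.sum_sum_type]
    simp [twistedHankelTensor]
  simp only [h1, map_zero, LinearMap.zero_apply, Finset.sum_const_zero, zero_add]
  refine Finset.sum_congr rfl fun j _ => ?_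
  congr 2
  ext i
  rw [← sum_coeff_mul_ite hq, Fintype.sum_sum_type]
  simp [twistedHankelTensor]

/-- The values of the components of a kernel element satisfy a weighted linear relation: the
coordinate at the additional basis vector of the relation for `g₁ = nodal x`, contracted with the
evaluations at the points `x`. -/
theorem sum_coeff_nodal_mul_formValue [Nontrivial A]
    (hW : ∀ k, ∑ j, wedge ℂ _ (fun i => twistedHankelTensor s p i j k) (W j) = 0)
    (x : Fin p → A) :
    ∑ j : Fin (p + 1), (∑ k : Fin (p + 1), (nodal x).coeff k *
      ((-1) ^ (k : ℕ) * algebraMap ℂ A (s (j + k)))) * formValue (2 * p) x (W (.inr j)) = 0 := by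
  have h := sum_wedge_twistedHankelTensor_inl (A := A) hW (q := nodal x)
    (by rw [nodal_natDegree]; omega)
  set u₁ : Fin p → Fin (2 * p + 1) → A := fun j i => (X ^ (j : ℕ) * nodal x).coeff i with hu₁
  set u₂ : Fin (p + 1) → Fin (2 * p + 1) → A := fun j i => if (i : ℕ) = 2 * p then
    ∑ k : Fin (p + 1), (nodal x).coeff k * ((-1) ^ (k : ℕ) * algebraMap ℂ A (s (j + k))) else 0
    with hu₂
  have hdeg : ∀ j : Fin p, (X ^ (j : ℕ) * nodal x).natDegree < 2 * p :=
    fun j => natDegree_X_pow_mul_nodal_lt x j (by omega)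
  have key := sum_wedge_contractMulti (Sum.elim u₁ u₂) (fun j => algebraMap ℂ A ∘ W j)
    (by rw [Fintype.sum_sum_type]; exact h) (fun t => evalCovector _ (2 * p) (x t)) (by
      rintro t (j | j)
      · exact (evalCovector_dotProduct_coeff (by omega) _ (hdeg j)).trans
          (by rw [eval_mul, eval_nodal_self, mul_zero])
      · refine Finset.sum_eq_zero fun i _ => ?_
        by_cases hi : (i : ℕ) = 2 * p
        · rw [evalCovector_of_le _ hi.ge, zero_mul]
        · simp [hu₂, hi])
  have h2 := congrFun key {⟨2 * p, by omega⟩}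
  rw [Finset.sum_apply, Fintype.sum_sum_type] at h2
  simp only [wedge_apply_singleton, Sum.elim_inl, Sum.elim_inr, hu₁, hu₂, if_true,
    coeff_eq_zero_of_natDegree_lt (hdeg _), zero_mul, Finset.sum_const_zero, zero_add] at h2
  exact h2

/-- The values of the components of a kernel element satisfy an exchange relation in two points `y`
and `z`, from pairing with the polynomial `g₂ = nodal x` that vanishes at the other points. -/
theorem formValue_exchange [Nontrivial A] {k : ℕ}
    {W : Fin (k + 1) ⊕ Fin (k + 2) → Finset (Fin (2 * (k + 1) + 1)) → ℂ}
    (hW : ∀ l, ∑ j, wedge ℂ _ (fun i => twistedHankelTensor s (k + 1) i j l) (W j) = 0)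
    (x : Fin k → A) (y z : A) :
    ∑ j : Fin (k + 2), z ^ (j : ℕ) * (nodal x).eval z *
        formValue (2 * (k + 1)) (Matrix.vecCons y x) (W (.inr j)) =
      ∑ j : Fin (k + 2), y ^ (j : ℕ) * (nodal x).eval y *
        formValue (2 * (k + 1)) (Matrix.vecCons z x) (W (.inr j)) := by
  have h := sum_wedge_twistedHankelTensor_inr (A := A) hW (q := nodal x)
    (by rw [nodal_natDegree]; omega)
  have hdeg : ∀ j : Fin (k + 2), (X ^ (j : ℕ) * nodal x).natDegree < 2 * (k + 1) :=
    fun j => natDegree_X_pow_mul_nodal_lt x j (by omega)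
  have key := sum_dotProduct_mul_contract (sum_wedge_contractMulti _ _ h
    (fun t => evalCovector _ (2 * (k + 1)) (x t)) fun t j => by
      rw [evalCovector_dotProduct_coeff (by omega) _ (hdeg j), eval_mul, eval_nodal_self,
        mul_zero]) (evalCovector _ (2 * (k + 1)) y) (evalCovector _ (2 * (k + 1)) z)
  simp only [evalCovector_dotProduct_coeff (show 2 * (k + 1) ≤ 2 * (k + 1) + 1 by omega) _
    (hdeg _), eval_mul, eval_pow, eval_X] at key
  have hcons : ∀ (y : A) (j : Fin (k + 2)),
      contract A _ (evalCovector _ (2 * (k + 1)) y) (contractMulti A _ k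
        (fun t => evalCovector _ (2 * (k + 1)) (x t)) (algebraMap ℂ A ∘ W (.inr j))) ∅ =
      formValue (2 * (k + 1)) (Matrix.vecCons y x) (W (.inr j)) := fun y j => by
    rw [formValue, contractMulti_succ]; rfl
  simpa only [hcons] using key

end Relations

section Injectivity

variable {s : ℕ → ℂ} {p k : ℕ}

/-- The components of a kernel element on polynomials `f₂` vanish if their values at all
families of evaluations do. -/
theorem apply_inr_eq_zero_of_formValue_eq_zero
    {W : Fin (k + 1) ⊕ Fin (k + 2) → Finset (Fin (2 * (k + 1) + 1)) → ℂ}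
    (hdeg : ∀ j S, S.card ≠ k + 1 → W j S = 0)
    (hW : ∀ l, ∑ j, wedge ℂ _ (fun i => twistedHankelTensor s (k + 1) i j l) (W j) = 0)
    (hval : ∀ (x : Fin (k + 1) → ℂ) j, formValue (2 * (k + 1)) x (W (.inr j)) = 0)
    (j : Fin (k + 2)) : W (.inr j) = 0 := by
  set z : Fin (2 * (k + 1) + 1) := ⟨2 * (k + 1), by omega⟩ with hz
  set K : Finset (Fin (2 * (k + 1) + 1)) := Finset.univ.erase z with hK
  have hKlt : ∀ i ∈ K, (i : ℕ) < 2 * (k + 1) := fun i hi => by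
    have h1 : i ≠ z := Finset.ne_of_mem_erase hi
    have h2 : (i : ℕ) ≠ 2 * (k + 1) := fun h => h1 (Fin.ext h)
    omega
  have hΞ : ∀ h : Fin (2 * (k + 1) + 1) → ℂ,
      (∀ ξ ∈ Set.range (evalCovector _ (2 * (k + 1))), ξ ⬝ᵥ h = 0) →
      ∀ i ∈ K, h i = 0 := fun h hh i hi =>
    eq_zero_of_forall_evalCovector_dotProduct h (fun x => hh _ ⟨x, rfl⟩) i (hKlt i hi)
  ext S
  by_cases hS : S.card = k + 1
  swap
  · exact hdeg _ S hS
  by_cases hzS : z ∈ S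
  swap
  · refine eq_zero_of_contractMulti_eq_zero hΞ (k := k + 1) (l := 0) (W (.inr j)) ?_ S
      (fun i hi => Finset.mem_erase.2 ⟨fun h => hzS (h ▸ hi), Finset.mem_univ i⟩) (by omega)
    intro ξ hξ Q _ hQ
    obtain rfl := Finset.card_eq_zero.1 hQ
    choose x hx using hξ
    rw [← hval x j, ← funext hx]
    rfl
  -- The part of the form that contains the vector `z`: its contraction with the dual of `z`.
  have hc : contract ℂ _ (Pi.single z 1) (W (.inr j)) (S.erase z) = 0 := by
    refine eq_zero_of_contractMulti_eq_zero hΞ (k := k) (l := 0) _ ?_ (S.erase z)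
      (Finset.erase_subset_erase z (Finset.subset_univ S))
      (by rw [Finset.card_erase_of_mem hzS]; omega)
    intro ξ hξ Q _ hQ
    obtain rfl := Finset.card_eq_zero.1 hQ
    choose x hx using hξ
    have h := sum_wedge_twistedHankelTensor_inr (A := ℂ) hW (q := nodal x)
      (by rw [nodal_natDegree]; omega)
    have h2 := sum_wedge_contractMulti _ _ h (fun _ : Fin 1 => Pi.single z 1) (fun _ j => by
      rw [single_dotProduct, one_mul]
      exact Polynomial.coeff_eq_zero_of_natDegree_lt
        (natDegree_X_pow_mul_nodal_lt x j (by simp only [hz]; omega)))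
    simp only [contractMulti_succ, contractMulti_zero] at h2
    exact contractMulti_eq_zero_of_sum_wedge (d := 2 * (k + 1)) (by omega) (by omega) h2
      (fun t i hi => by rw [← hx t, evalCovector_of_lt _ hi]) j
  rw [contract_apply, Finset.sum_apply, Finset.sum_eq_single z (fun i _ hi => by simp [hi])
    (by simp)] at hc
  rw [Pi.single_eq_same, one_smul, contractBasis_apply, if_neg (Finset.notMem_erase z S),
    Finset.insert_erase hzS] at hc
  have := congrArg (wedgeSign ℂ (S.erase z) z * ·) hc
  simpa [← mul_assoc, wedgeSign_mul_self] using this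

/-- Without components on polynomials `f₂`, the remaining ones satisfy the relations of a Hankel
tensor. -/
theorem apply_inl_eq_zero_of_apply_inr_eq_zero
    {W : Fin p ⊕ Fin (p + 1) → Finset (Fin (2 * p + 1)) → ℂ}
    (hdeg : ∀ j S, S.card ≠ p → W j S = 0)
    (hW : ∀ l, ∑ j, wedge ℂ _ (fun i => twistedHankelTensor s p i j l) (W j) = 0)
    (hinr : ∀ j, W (.inr j) = 0) (j : Fin p) : W (.inl j) = 0 := by
  ext S
  by_cases hS : S.card = p
  swap
  · exact hdeg _ S hS
  refine eq_zero_of_contractMulti_eq_zero (K := Finset.univ) (k := p) (l := 0)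
    (Ξ := {ξ | ∃ x, ∀ i : Fin (2 * p + 1), (i : ℕ) < 2 * p → ξ i = x ^ (i : ℕ)})
    (fun h hh i _ => eq_zero_of_forall_dotProduct_geom h hh i) (W (.inl j)) ?_ S
    (Finset.subset_univ S) (by omega)
  intro ξ hξ Q _ hQ
  obtain rfl := Finset.card_eq_zero.1 hQ
  choose x hx using hξ
  have h := sum_wedge_twistedHankelTensor_inl (A := ℂ) hW (q := nodal x)
    (by rw [nodal_natDegree]; omega)
  have h0 : ∀ j, algebraMap ℂ ℂ ∘ W (.inr j) = 0 := fun j => by rw [hinr]; ext; simp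
  simp only [h0, map_zero, Finset.sum_const_zero, add_zero] at h
  exact contractMulti_eq_zero_of_sum_wedge (d := 2 * p) (by omega) (by omega) h hx j

/-- With suitable weights, the flattening of the twisted Hankel tensor is injective: the values of
an element of the kernel at generic points are polynomials to which `exists_weights_ofCoeffs`
applies. -/
theorem exists_flatteningInjective_square (hp : 0 < p) :
    ∃ T : Fin (2 * p + 1) → Fin p ⊕ Fin (p + 1) → Fin (p + 1) ⊕ Fin p → ℂ,
      FlatteningInjective p T := by
  obtain ⟨k, rfl⟩ := Nat.exists_eq_succ_of_ne_zero hp.ne'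
  obtain ⟨s, hs⟩ := exists_weights_ofCoeffs k
  refine ⟨twistedHankelTensor s (k + 1), fun W hdeg hW => ?_⟩
  have hzero : (fun j => formValue (2 * (k + 1))
      (MvPolynomial.X : Fin (k + 1) → MvPolynomial (Fin (k + 1)) ℂ) (W (.inr j))) = 0 := by
    refine hs _ (fun j x y hxy => ?_) ?_ (sum_coeff_nodal_mul_formValue hW _)
    · rw [map_formValue, ← formValue_comp_swap _ _ _ hxy]
      congr 1
      ext1 i
      simp
    · have h := formValue_exchange hW (fun t : Fin k =>
        (MvPolynomial.X t.succ.succ : MvPolynomial (Fin (k + 2)) ℂ)) (.X 1) (.X 0)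
      simp only [eval_nodal] at h
      simp only [ofCoeffs, map_sum, map_mul, map_pow, map_formValue, MvPolynomial.rename_X,
        Finset.sum_mul, Equiv.swap_apply_left]
      convert h using 2 with j _ j _
      · rw [mul_comm, mul_comm _ (MvPolynomial.X 0 ^ (j : ℕ)), ← mul_assoc, mul_comm (∏ _, _)]
        congr 2
        ext1 t
        induction t using Fin.cases <;> simp
      · rw [mul_comm, mul_comm _ (MvPolynomial.X 1 ^ (j : ℕ)), ← mul_assoc, mul_comm (∏ _, _)]
        congr 2
        ext1 t
        induction t using Fin.cases with
        | zero => simp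
        | succ t =>
          simp only [Function.comp_apply, MvPolynomial.rename_X, Matrix.cons_val_succ]
          rw [Equiv.swap_apply_of_ne_of_ne] <;> simp [Fin.ext_iff]
  have hinr := apply_inr_eq_zero_of_formValue_eq_zero hdeg hW fun x j => by
    have := congrArg (MvPolynomial.aeval x) (congrFun hzero j)
    rw [map_formValue, Pi.zero_apply, map_zero] at this
    rw [← this]
    congr 1
    ext1 i
    simp
  ext1 j
  rcases j with j | j
  · exact apply_inl_eq_zero_of_apply_inr_eq_zero hdeg hW hinr j
  · exact hinr j

end Injectivity

end TwistedHankel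

/-! ### Equations for the border rank -/

/-- The quotient of the binomial coefficients is `(2 * p + 1) / (p + 1)`. -/
theorem mul_choose_lt_odd {r p m : ℕ} (h : r * (p + 1) < (2 * p + 1) * m) :
    r * (2 * p + 1 - 1).choose p < (2 * p + 1).choose p * m := by
  have h1 : (2 * p + 1).choose p * (p + 1) = (2 * p + 1) * (2 * p).choose p := by
    have := Nat.add_one_mul_choose_eq (2 * p) p
    rw [← Nat.choose_symm_half]
    linarith
  have h2 : 0 < (2 * p).choose p := Nat.choose_pos (by omega)
  refine Nat.lt_of_mul_lt_mul_right (a := p + 1) ?_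
  calc r * (2 * p + 1 - 1).choose p * (p + 1) = r * (p + 1) * (2 * p).choose p := by
        rw [Nat.add_sub_cancel]; ring
    _ < (2 * p + 1) * m * (2 * p).choose p := Nat.mul_lt_mul_of_pos_right h h2
    _ = (2 * p + 1).choose p * m * (p + 1) := by
        rw [mul_right_comm, ← h1]; ring

/-- The quotient of the binomial coefficients is `(2 * p + 2) / (p + 2)`. -/
theorem mul_choose_lt_even {r p m : ℕ} (h : r * (p + 2) < (2 * p + 2) * m) :
    r * (2 * p + 2 - 1).choose p < (2 * p + 2).choose p * m := by
  have h1 : (2 * p + 2).choose p * (p + 2) = (2 * p + 2) * (2 * p + 1).choose p := by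
    have := Nat.add_one_mul_choose_eq (2 * p + 1) (p + 1)
    have h3 : (2 * p + 2).choose p = (2 * p + 2).choose (p + 2) :=
      (Nat.choose_symm_of_eq_add (by omega))
    rw [h3, ← Nat.choose_symm_half]
    linarith
  have h2 : 0 < (2 * p + 1).choose p := Nat.choose_pos (by omega)
  refine Nat.lt_of_mul_lt_mul_right (a := p + 2) ?_
  calc r * (2 * p + 2 - 1).choose p * (p + 2) = r * (p + 2) * (2 * p + 1).choose p := by
        rw [show 2 * p + 2 - 1 = 2 * p + 1 from rfl]; ring
    _ < (2 * p + 2) * m * (2 * p + 1).choose p := Nat.mul_lt_mul_of_pos_right h h2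
    _ = (2 * p + 2).choose p * m * (p + 2) := by
        rw [mul_right_comm, ← h1]; ring

/-- For odd `n`, the dimension `n * n = 2 * p + 1` of `B` and `C` calls for the twisted Hankel
tensor. -/
theorem nontrivialEquations_odd {n p a : ℕ} (hn : 3 ≤ n) (hm : n * n = 2 * p + 1)
    (ha : a = 2 * p + 1) (Φ : Matrix (Fin a) (Fin (n * n)) ℂ) (hΦ : Φ.rank = a) :
    NontrivialEquations (b := n * n) (c := n * n) (2 * n ^ 2 - n + 1) (youngEquations Φ p) := by
  obtain ⟨T, hT⟩ := exists_flatteningInjective_square (p := p) (by nlinarith)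
  subst ha
  refine nontrivialEquations_of_flatteningInjective hΦ le_rfl (mul_choose_lt_odd ?_) hT
    (Fintype.equivFinOfCardEq (by simp; omega)) (Fintype.equivFinOfCardEq (by simp; omega))
  obtain ⟨s, hs⟩ : ∃ s, 2 * n ^ 2 - n + 1 = s ∧ s + n = 2 * (n * n) + 1 :=
    ⟨_, rfl, by have : n ≤ 2 * n ^ 2 := by nlinarith
                have h2 : n ^ 2 = n * n := sq n
                omega⟩
  rw [hs.1]
  nlinarith

/-- For even `n`, the dimension of `B` and `C` is that of two copies of the polynomials of degree at
most `p`. For `n = 4` and `a = 16`, the size of the flattening does not exceed the bound on its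
rank. -/
theorem nontrivialEquations_even {n p a : ℕ} (hn : 4 ≤ n) (hm : n * n = 2 * p + 2)
    (ha : a = 2 * p + 1 ∨ a = 2 * p + 2 ∧ n ≠ 4) (Φ : Matrix (Fin a) (Fin (n * n)) ℂ)
    (hΦ : Φ.rank = a) :
    NontrivialEquations (b := n * n) (c := n * n) (2 * n ^ 2 - n + 1) (youngEquations Φ p) := by
  obtain ⟨s, hs⟩ : ∃ s, 2 * n ^ 2 - n + 1 = s ∧ s + n = 2 * (n * n) + 1 :=
    ⟨_, rfl, by have : n ≤ 2 * n ^ 2 := by nlinarith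
                have h2 : n ^ 2 = n * n := sq n
                omega⟩
  refine nontrivialEquations_of_flatteningInjective hΦ (by omega) ?_
    (flatteningInjective_hankelTensor (a := a) (p := p) (by omega))
    (Fintype.equivFinOfCardEq (by simp; omega)) (Fintype.equivFinOfCardEq (by simp; omega))
  rw [hs.1]
  obtain rfl | ⟨rfl, h4⟩ := ha
  · refine mul_choose_lt_odd ?_
    nlinarith
  · refine mul_choose_lt_even ?_
    have : 5 ≤ n := by omega
    nlinarith

theorem corollary1p3 (n : ℕ) (hn : 3 ≤ n) :
    (n ≠ 4 →
      NontrivialEquations (a := n * n) (b := n * n) (c := n * n) (2 * n ^ 2 - n + 1)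
          (youngEquations (1 : Matrix (Fin (n * n)) (Fin (n * n)) ℂ) ((n * n - 1) / 2)) ∧
        ∀ P ∈ youngEquations (b := n * n) (c := n * n)
            (1 : Matrix (Fin (n * n)) (Fin (n * n)) ℂ) ((n * n - 1) / 2),
          P.evalAt (matMulTensor n) = 0) ∧
    (∀ Φ : Matrix (Fin (2 * ((n * n - 1) / 2) + 1)) (Fin (n * n)) ℂ,
      Φ.rank = 2 * ((n * n - 1) / 2) + 1 →
      NontrivialEquations (a := n * n) (b := n * n) (c := n * n) (2 * n ^ 2 - n + 1)
          (youngEquations Φ ((n * n - 1) / 2)) ∧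
        ∀ P ∈ youngEquations (b := n * n) (c := n * n) Φ ((n * n - 1) / 2),
          P.evalAt (matMulTensor n) = 0) := by
  set p := (n * n - 1) / 2 with hp
  have hsq : 9 ≤ n * n := by nlinarith
  have hnp : n ≤ p := by
    have : 3 * n ≤ n * n := Nat.mul_le_mul_right n hn
    omega
  have hvanish : ∀ {a : ℕ}, 2 * p + 1 ≤ a → ∀ Φ : Matrix (Fin a) (Fin (n * n)) ℂ,
      ∀ P ∈ youngEquations (b := n * n) (c := n * n) Φ p, P.evalAt (matMulTensor n) = 0 :=
    fun ha Φ P hP => evalAt_matMulTensor_eq_zero (by omega) hnp ha Φ hP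
  have hone : (1 : Matrix (Fin (n * n)) (Fin (n * n)) ℂ).rank = n * n := by simp
  rcases Nat.even_or_odd n with hpar | hpar
  · have hm : n * n = 2 * p + 2 := by
      obtain ⟨k, rfl⟩ := hpar
      have : (k + k) * (k + k) = 2 * (2 * (k * k)) := by ring
      omega
    have h4 : 4 ≤ n := by
      rcases hn.eq_or_lt with rfl | h
      · exact absurd hpar (by decide)
      · exact h
    exact ⟨fun hn4 => ⟨nontrivialEquations_even h4 hm (Or.inr ⟨hm, hn4⟩) 1 hone,
      hvanish (by omega) 1⟩, fun Φ hΦ => ⟨nontrivialEquations_even h4 hm (Or.inl rfl) Φ hΦ,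
      hvanish le_rfl Φ⟩⟩
  · have hm : n * n = 2 * p + 1 := by
      obtain ⟨k, rfl⟩ := hpar
      have : (2 * k + 1) * (2 * k + 1) = 2 * (2 * (k * k) + 2 * k) + 1 := by ring
      omega
    exact ⟨fun _ => ⟨nontrivialEquations_odd hn hm hm 1 hone, hvanish (by omega) 1⟩,
      fun Φ hΦ => ⟨nontrivialEquations_odd hn hm rfl Φ hΦ, hvanish le_rfl Φ⟩⟩
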